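/- For $d\ge 1$ let $N_d$ be the group of $(d+1)\times(d+1)$ lower-triangular integer matrices with all diagonal entries equal to $1$. It acts on $\mathbb{Z}^d$ by $f\cdot(i_1,\dots,i_d)=(j_1,\dots,j_d)$, where $f(1,i_1,\dots,i_d)^T=(1,j_1,\dots,j_d)^T$. A \emph{Farb--Franks action} of $N_d$ is an action $\phi$ of $N_d$ on $[0,1]$ by orientation-preserving homeomorphisms for which there are closed intervals $I_i\subset[0,1]$ ($i\in\mathbb{Z}^d$) of positive lengths with total length $1$, placed next to each other on $[0,1]$ in the lexicographic order of $\mathbb{Z}^d$, such that $\phi(f)(I_i)=I_{f\cdot i}$ for all $f\in N_d$ and $i\in\mathbb{Z}^d$, and such that the maps between these intervals are equivariant, i.e. $\phi(f)|_{I_i}=\phi(g)|_{I_i}$ whenever $f\cdot i=g\cdot i$. (All such actions are topologically conjugate to each other; $\phi_{FF}$, the action constructed by Farb and Franks, is one of them.) Theorem B. Let $d\ge 2$ and $0<\alpha<\frac{2}{d(d-1)}$. Then Farb--Franks actions of $N_d$ exist, and every Farb--Franks action of $N_d$ (in particular $\phi_{FF}$) is topologically conjugate to an action of $N_d$ on $[0,1]$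 by orientation-preserving $C^{1+\alpha}$ diffeomorphisms, that is, $C^1$ diffeomorphisms $h$ of $[0,1]$ for which there is a constant $M$ with $|h'(x)-h'(y)|\le M|x-y|^\alpha$ for all $x,y\in[0,1]$. -/

import Mathlib

/-- `N_d`: the group of `(d+1) × (d+1)` lower-triangular integer matrices all of whose diagonal
entries are `1` (realized inside `SL(d+1, ℤ)`). -/
def lowerUnitriangular (d : ℕ) : Subgroup (Matrix.SpecialLinearGroup (Fin (d + 1)) ℤ) where
  carrier := {A | (∀ i, A.1 i i = 1) ∧ ∀ i j, i < j → A.1 i j = 0}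
  one_mem' := by
    refine ⟨fun i => by simp, fun i j hij => ?_⟩
    simp [hij.ne]
  mul_mem' := by
    rintro A B ⟨hA1, hA0⟩ ⟨hB1, hB0⟩
    refine ⟨fun i => ?_, fun i j hij => ?_⟩
    · rw [Matrix.SpecialLinearGroup.coe_mul, Matrix.mul_apply, Finset.sum_eq_single i]
      · rw [hA1, hB1, one_mul]
      · intro k _ hk
        rcases lt_or_gt_of_ne hk with h | h
        · rw [hB0 k i h, mul_zero]
        · rw [hA0 i k h, zero_mul]
      · simp
    · rw [Matrix.SpecialLinearGroup.coe_mul, Matrix.mul_apply]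
      refine Finset.sum_eq_zero fun k _ => ?_
      rcases lt_or_ge i k with h | h
      · rw [hA0 i k h, zero_mul]
      · rw [hB0 k j (lt_of_le_of_lt h hij), mul_zero]
  inv_mem' := by
    rintro A ⟨hA1, hA0⟩
    have hmul : A.1 * (A⁻¹).1 = 1 := by
      rw [← Matrix.SpecialLinearGroup.coe_mul, mul_inv_cancel, Matrix.SpecialLinearGroup.coe_one]
    have key : ∀ i j : Fin (d + 1), i ≤ j →
        (A⁻¹).1 i j = (1 : Matrix (Fin (d + 1)) (Fin (d + 1)) ℤ) i j := by
      intro i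
      induction i using WellFoundedLT.induction with
      | _ i ih =>
        intro j hij
        have h := congrFun (congrFun hmul i) j
        rw [Matrix.mul_apply, Finset.sum_eq_single i] at h
        · rwa [hA1, one_mul] at h
        · intro k _ hk
          rcases lt_or_gt_of_ne hk with hki | hki
          · rw [ih k hki j (hki.le.trans hij), Matrix.one_apply_ne (hki.trans_le hij).ne, mul_zero]
          · rw [hA0 i k hki, zero_mul]
        · simp
    exact ⟨fun i => by rw [key i i le_rfl, Matrix.one_apply_eq],
      fun i j hij => by rw [key i j hij.le, Matrix.one_apply_ne hij.ne]⟩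

namespace FarbFranks

/-- The action of `N_d` on `ℤ^d` induced by the linear action on the affine hyperplane
`1 × ℤ^d` of `ℤ^{d+1}`: `f (1, i_1, …, i_d)ᵀ = (1, j_1, …, j_d)ᵀ`. -/
def act {d : ℕ} (f : lowerUnitriangular d) (i : Fin d → ℤ) : Fin d → ℤ :=
  fun k => f.1.1.mulVec (Fin.cons 1 i : Fin (d + 1) → ℤ) k.succ

/-- The left endpoint of the interval `I_i` when intervals of lengths `ℓ` are joined
lexicographically, starting at `0`. -/
noncomputable def leftEnd {d : ℕ} (ℓ : (Fin d → ℤ) → ℝ) (i : Fin d → ℤ) : ℝ :=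
  ∑' j : {j : Fin d → ℤ // toLex j < toLex i}, ℓ j.1

/-- The closed subinterval `I_i` of `[0,1]`, of length `ℓ i`. -/
def block {d : ℕ} (ℓ : (Fin d → ℤ) → ℝ) (i : Fin d → ℤ) : Set unitInterval :=
  {x | leftEnd ℓ i ≤ (x : ℝ) ∧ (x : ℝ) ≤ leftEnd ℓ i + ℓ i}

/-- `φ` is a Farb-Franks action of `N_d` on `[0,1]`: it acts by orientation-preserving
homeomorphisms, and there are closed intervals `I_i` (`i ∈ ℤ^d`) of positive lengths with total
length `1`, joined lexicographically on `[0,1]`, such that every `f ∈ N_d` sends `I_i` onto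
`I_{f i}`, and does so equivariantly: the map `I → J` between two of the intervals depends only
on `I` and `J`, not on the group element inducing it. -/
def IsFarbFranksAction (d : ℕ) (φ : lowerUnitriangular d →* (unitInterval ≃ₜ unitInterval)) :
    Prop :=
  (∀ f, StrictMono (φ f)) ∧
  ∃ ℓ : (Fin d → ℤ) → ℝ, (∀ i, 0 < ℓ i) ∧ HasSum ℓ 1 ∧
    (∀ f i, φ f '' block ℓ i = block ℓ (act f i)) ∧
    ∀ f g i, act f i = act g i → Set.EqOn (φ f) (φ g) (block ℓ i)

/-- `h` is an orientation-preserving `C^{1+α}` diffeomorphism of `[0,1]`: it has at every point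
of `[0,1]` (one-sided at the endpoints) a positive derivative, which is `α`-Hölder on `[0,1]`.
The inverse of such a map is again differentiable, the derivative having no zeros. -/
def IsC1HolderDiffeo (α : ℝ) (h : unitInterval ≃ₜ unitInterval) : Prop :=
  ∃ h' : unitInterval → ℝ,
    (∀ x : unitInterval, 0 < h' x ∧
      HasDerivWithinAt (fun t : ℝ => (h (Set.projIcc 0 1 zero_le_one t) : ℝ)) (h' x)
        (Set.Icc 0 1) (x : ℝ)) ∧
    ∃ M : ℝ, ∀ x y : unitInterval, |h' x - h' y| ≤ M * |(x : ℝ) - (y : ℝ)| ^ α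

/-- Two actions on `[0,1]` are topologically conjugate. -/
def TopConj {G : Type*} [Group G] (φ ψ : G →* (unitInterval ≃ₜ unitInterval)) : Prop :=
  ∃ h : unitInterval ≃ₜ unitInterval, ∀ g x, h (φ g x) = ψ g (h x)

end FarbFranks

namespace FarbFranks

open MeasureTheory Set Filter Topology

/-!
Grouping the intervals `I_i` by the first `n = d - 1` coordinates `v` of `i` turns an action of
`N_d` into the action `(v, t) ↦ (f v, t + c_f v)` on the lexicographically ordered set `ℤ^n × ℝ`.
Any two order embeddings of `ℤ^n × ℝ` in `[0,1]` with dense image differ by a homeomorphism of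
`[0,1]`, so up to conjugacy one is free to choose the embedding.

Let `level v` be the homogeneous size of `v`, in which the `k`-th coordinate has weight `k`. It
changes by a bounded amount under `f`, and `∑ v, level v ^ (-1/α)` converges if and only if
`1/α > 1 + 2 + ⋯ + n`. So give the block over `v` a length proportional to `level v ^ (-1/α)`,
and map the fibre `ℝ` to it by the distribution function of a density proportional to
`‖t + a i‖ ^ (-p)`, with `a` a power of `level v` and `p` such that the constant of
proportionality is the same for all blocks. The derivative of a group element is then the `p`-th
power of the modulus of a Möbius map `(t + a i) / (t + c + b i)`. It tends to `1` at both ends of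
the block, so that the pieces fit together, and it differs from `1` by `O(1 / level v)`, which is
the order of the length of the block to the power `α`: this is the Hölder estimate.
-/

section OrderExtension

variable {X Y Z : Type*} [TopologicalSpace Y] [CompleteLinearOrder Z] [TopologicalSpace Z]
  [OrderTopology Z] [DenselyOrdered Z] {P : X → Y} {Q : X → Z}

theorem exists_monotone_extension [LinearOrder Y] [OrderTopology Y] (hQ : DenseRange Q)
    (h : ∀ x x', P x ≤ P x' → Q x ≤ Q x') :
    ∃ F : Y → Z, Monotone F ∧ Continuous F ∧ ∀ x, F (P x) = Q x := by
  let F : Y → Z := fun y => sSup (Q '' {x | P x ≤ y})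
  have hmono : Monotone F := fun y y' hy => sSup_le_sSup (image_mono fun x hx => le_trans hx hy)
  have hFP : ∀ x, F (P x) = Q x := fun x => by
    refine le_antisymm (sSup_le ?_) (le_sSup (mem_image_of_mem Q (le_refl (P x))))
    rintro _ ⟨x', hx', rfl⟩
    exact h x' x hx'
  have hdense : DenseRange F := hQ.mono (range_subset_iff.2 fun x => ⟨P x, hFP x⟩)
  exact ⟨F, hmono, hmono.continuous_of_denseRange hdense, hFP⟩

variable [CompleteLinearOrder Y] [OrderTopology Y] [DenselyOrdered Y]

theorem exists_orderIso_of_denseRange (hP : DenseRange P) (hQ : DenseRange Q)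
    (h : ∀ x x', P x < P x' ↔ Q x < Q x') : ∃ H : Y ≃o Z, ∀ x, H (P x) = Q x := by
  have hle : ∀ x x', P x ≤ P x' ↔ Q x ≤ Q x' := fun x x' => by
    simpa only [not_lt] using not_congr (h x' x)
  obtain ⟨F, hFmono, hFcont, hF⟩ := exists_monotone_extension hQ fun x x' => (hle x x').1
  obtain ⟨E, hEmono, hEcont, hE⟩ := exists_monotone_extension hP fun x x' => (hle x x').2
  have hEF : E ∘ F = id := hP.equalizer (hEcont.comp hFcont) continuous_id <| by
    funext x
    simp only [Function.comp_apply, hF, hE, id]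
  have hFE : F ∘ E = id := hQ.equalizer (hFcont.comp hEcont) continuous_id <| by
    funext x
    simp only [Function.comp_apply, hF, hE, id]
  exact ⟨(Equiv.mk F E (congrFun hEF) (congrFun hFE)).toOrderIso hFmono hEmono, hF⟩

theorem exists_hom_homeomorph_extending {G : Type*} [Group G] (hP : DenseRange P)
    (A : G →* Equiv.Perm X) (hA : ∀ g x x', P x < P x' ↔ P (A g x) < P (A g x')) :
    ∃ φ : G →* (Y ≃ₜ Y), (∀ g, StrictMono (φ g)) ∧ ∀ g x, φ g (P x) = P (A g x) := by
  have hPA : ∀ g, DenseRange fun x => P (A g x) := fun g =>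
    (congrArg Dense ((A g).surjective.range_comp P)).mpr hP
  choose H hH using fun g => exists_orderIso_of_denseRange hP (hPA g) (hA g)
  refine ⟨MonoidHom.mk' (fun g => (H g).toHomeomorph) fun g g' => ?_,
    fun g => (H g).strictMono, hH⟩
  refine Homeomorph.ext fun y => congrFun (hP.equalizer (H (g * g')).continuous
    ((H g).continuous.comp (H g').continuous) ?_) y
  funext x
  simp only [Function.comp_apply, hH, map_mul, Equiv.Perm.mul_apply]

end OrderExtension

theorem topConj_of_denseRange {X G : Type*} [Group G] {P Q : X → unitInterval}
    (hP : DenseRange P) (hQ : DenseRange Q) (h : ∀ x x', P x < P x' ↔ Q x < Q x')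
    {A : G → X → X} {φ ψ : G →* (unitInterval ≃ₜ unitInterval)}
    (hφ : ∀ g x, φ g (P x) = P (A g x)) (hψ : ∀ g x, ψ g (Q x) = Q (A g x)) : TopConj φ ψ := by
  obtain ⟨H, hH⟩ := exists_orderIso_of_denseRange hP hQ h
  refine ⟨H.toHomeomorph, fun g y => congrFun (hP.equalizer (H.continuous.comp (φ g).continuous)
    ((ψ g).continuous.comp H.continuous) ?_) y⟩
  funext x
  simp only [Function.comp_apply, hφ, hH, hψ]

section Action

variable {d : ℕ}

theorem cons_act (f : lowerUnitriangular d) (i : Fin d → ℤ) :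
    (Fin.cons 1 (act f i) : Fin (d + 1) → ℤ) = f.1.1.mulVec (Fin.cons 1 i) := by
  funext k
  refine Fin.cases ?_ (fun k => ?_) k
  · rw [Fin.cons_zero, Matrix.mulVec, dotProduct, Fin.sum_univ_succ]
    rw [Finset.sum_eq_zero fun l _ => by rw [f.2.2 0 l.succ l.succ_pos, zero_mul]]
    simp [f.2.1 0]
  · rw [Fin.cons_succ]; rfl

theorem act_mul (f g : lowerUnitriangular d) (i : Fin d → ℤ) :
    act (f * g) i = act f (act g i) := by
  have h : (Fin.cons 1 (act (f * g) i) : Fin (d + 1) → ℤ) = Fin.cons 1 (act f (act g i)) := by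
    rw [cons_act, cons_act, cons_act, Matrix.mulVec_mulVec]
    rfl
  exact Fin.cons_right_injective _ h

theorem act_one (i : Fin d → ℤ) : act (1 : lowerUnitriangular d) i = i := by
  have h : (Fin.cons 1 (act (1 : lowerUnitriangular d) i) : Fin (d + 1) → ℤ) = Fin.cons 1 i := by
    rw [cons_act]
    exact Matrix.one_mulVec _
  exact Fin.cons_right_injective _ h

theorem act_eq_add (f : lowerUnitriangular d) (i : Fin d → ℤ) (k : Fin d) :
    act f i k = i k + f.1.1 k.succ 0 +
      ∑ l ∈ Finset.univ.filter (· < k), f.1.1 k.succ l.succ * i l := by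
  rw [act, Matrix.mulVec, dotProduct, Fin.sum_univ_succ]
  simp only [Fin.cons_zero, mul_one, Fin.cons_succ]
  rw [← Finset.sum_filter_add_sum_filter_not _ (· < k)]
  have h : ∑ l ∈ Finset.univ.filter (fun l => ¬ l < k), f.1.1 k.succ l.succ * i l = i k := by
    rw [Finset.sum_eq_single k]
    · rw [f.2.1, one_mul]
    · intro l hl hlk
      have hl' : k < l := lt_of_le_of_ne (not_lt.1 (Finset.mem_filter.1 hl).2) (Ne.symm hlk)
      rw [f.2.2 _ _ (Fin.succ_lt_succ_iff.2 hl'), zero_mul]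
    · simp
  rw [h]
  ring

theorem toLex_lt_iff {i j : Fin d → ℤ} :
    toLex i < toLex j ↔ ∃ k, (∀ l < k, i l = j l) ∧ i k < j k := Iff.rfl

theorem act_lt_act (f : lowerUnitriangular d) {i j : Fin d → ℤ} (h : toLex i < toLex j) :
    toLex (act f i) < toLex (act f j) := by
  obtain ⟨k, hk, hlt⟩ := toLex_lt_iff.1 h
  have key : ∀ m ≤ k, act f i m - i m = act f j m - j m := by
    intro m hm
    rw [act_eq_add, act_eq_add]
    rw [Finset.sum_congr rfl fun l hl => by
      rw [hk l ((Finset.mem_filter.1 hl).2.trans_le hm)]]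
    ring
  refine toLex_lt_iff.2 ⟨k, fun l hl => ?_, ?_⟩
  · have := key l hl.le
    rw [hk l hl] at this
    linarith
  · have := key k le_rfl
    linarith

theorem exists_act_zero_eq (i : Fin d → ℤ) : ∃ f : lowerUnitriangular d, act f 0 = i := by
  let A : Matrix (Fin (d + 1)) (Fin (d + 1)) ℤ :=
    fun k l => if k = l then 1 else if l = 0 then (Fin.cons 1 i : Fin (d + 1) → ℤ) k else 0
  have hdiag : ∀ k, A k k = 1 := fun k => by simp [A]
  have hupper : ∀ k l, k < l → A k l = 0 := fun k l h => by
    simp [A, h.ne, ((Fin.zero_le k).trans_lt h).ne']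
  have hdet : A.det = 1 := by
    rw [Matrix.det_of_isLowerTriangular A fun k l h => hupper k l h]
    simp [hdiag]
  refine ⟨⟨⟨A, hdet⟩, hdiag, hupper⟩, ?_⟩
  funext k
  rw [act_eq_add]
  simp [A]

theorem exists_abs_act_sub_le (f : lowerUnitriangular d) :
    ∃ C : ℕ, ∀ (i : Fin d → ℤ) (k : Fin d) (r : ℕ), 1 ≤ r →
      (∀ l < k, |i l| ≤ (r : ℤ) ^ ((l : ℕ) + 1)) →
      |act f i k - i k| ≤ (C : ℤ) * (r : ℤ) ^ (k : ℕ) := by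
  refine ⟨∑ k, ∑ l, (f.1.1 k l).natAbs, fun i k r hr hi => ?_⟩
  have hr' : (1 : ℤ) ≤ r := by exact_mod_cast hr
  have hrow : |act f i k - i k| ≤ ∑ l, |f.1.1 k.succ l| * (r : ℤ) ^ (k : ℕ) := by
    rw [act_eq_add, Fin.sum_univ_succ]
    have : i k + f.1.1 k.succ 0 + ∑ l ∈ Finset.univ.filter (· < k), f.1.1 k.succ l.succ * i l - i k
      = f.1.1 k.succ 0 + ∑ l ∈ Finset.univ.filter (· < k), f.1.1 k.succ l.succ * i l := by ring
    rw [this]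
    refine (abs_add_le _ _).trans (add_le_add ?_ ?_)
    · exact le_mul_of_one_le_right (abs_nonneg _) (one_le_pow₀ hr')
    · refine (Finset.abs_sum_le_sum_abs _ _).trans ?_
      refine (Finset.sum_le_sum fun l hl => ?_).trans
        (Finset.sum_le_sum_of_subset_of_nonneg (Finset.filter_subset _ _)
          fun l _ _ => by positivity)
      have hl' : l < k := (Finset.mem_filter.1 hl).2
      rw [abs_mul]
      gcongr
      exact (hi l hl').trans (pow_le_pow_right₀ hr' hl')
  refine hrow.trans ?_
  rw [← Finset.sum_mul]
  gcongr
  push_cast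
  exact Finset.single_le_sum (f := fun k => ∑ l, |f.1.1 k l|)
    (fun k _ => Finset.sum_nonneg fun l _ => abs_nonneg _) (Finset.mem_univ k.succ)

end Action

section Skew

variable {n : ℕ}

theorem toLex_snoc_lt_snoc {v w : Fin n → ℤ} {j k : ℤ} :
    toLex (Fin.snoc v j : Fin (n + 1) → ℤ) < toLex (Fin.snoc w k : Fin (n + 1) → ℤ) ↔
      toLex v < toLex w ∨ v = w ∧ j < k := by
  rw [toLex_lt_iff, toLex_lt_iff]
  constructor
  · rintro ⟨m, hm, hlt⟩
    induction m using Fin.lastCases with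
    | last =>
      refine Or.inr ⟨funext fun l => ?_, by simpa using hlt⟩
      simpa using hm l.castSucc (Fin.castSucc_lt_last l)
    | cast m =>
      refine Or.inl ⟨m, fun l hl => ?_, by simpa using hlt⟩
      simpa using hm l.castSucc (Fin.castSucc_lt_castSucc_iff.2 hl)
  · rintro (⟨m, hm, hlt⟩ | ⟨rfl, hlt⟩)
    · refine ⟨m.castSucc, fun l hl => ?_, by simpa using hlt⟩
      induction l using Fin.lastCases with
      | last => exact absurd hl (not_lt.2 (Fin.le_last _))
      | cast l => simpa using hm l (Fin.castSucc_lt_castSucc_iff.1 hl)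
    · refine ⟨Fin.last n, fun l hl => ?_, by simpa using hlt⟩
      induction l using Fin.lastCases with
      | last => exact absurd hl (lt_irrefl _)
      | cast l => simp

theorem act_snoc_castSucc (f : lowerUnitriangular (n + 1)) (v : Fin n → ℤ) (j j' : ℤ) (k : Fin n) :
    act f (Fin.snoc v j) k.castSucc = act f (Fin.snoc v j') k.castSucc := by
  rw [act_eq_add, act_eq_add, Fin.snoc_castSucc, Fin.snoc_castSucc]
  congr 1
  refine Finset.sum_congr rfl fun l hl => ?_
  have hl' : l ≠ Fin.last n :=
    ((Finset.mem_filter.1 hl).2.trans (Fin.castSucc_lt_last k)).ne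
  obtain ⟨l, rfl⟩ := Fin.exists_castSucc_eq.2 hl'
  rw [Fin.snoc_castSucc, Fin.snoc_castSucc]

/-- The action of `N_{n+1}` on the first `n` coordinates of `ℤ^{n+1}`. -/
def baseAct : lowerUnitriangular (n + 1) →* Equiv.Perm (Fin n → ℤ) :=
  MonoidHom.toHomPerm
    { toFun f v := Fin.init (act f (Fin.snoc v 0))
      map_one' := by
        funext v
        rw [act_one, Fin.init_snoc]
        rfl
      map_mul' f g := by
        funext v k
        simp only [act_mul, Fin.init]
        rw [← Fin.snoc_init_self (act g (Fin.snoc v 0))]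
        exact act_snoc_castSucc f _ _ _ k }

/-- The translation of the last coordinate by `f` over the base point `v`. -/
def shift (f : lowerUnitriangular (n + 1)) (v : Fin n → ℤ) : ℤ :=
  act f (Fin.snoc v 0) (Fin.last n)

theorem act_snoc (f : lowerUnitriangular (n + 1)) (v : Fin n → ℤ) (j : ℤ) :
    act f (Fin.snoc v j) = Fin.snoc (baseAct f v) (j + shift f v) := by
  funext k
  induction k using Fin.lastCases with
  | last =>
    have hsum : ∀ i : ℤ, ∑ l ∈ Finset.univ.filter (· < Fin.last n),
        f.1.1 (Fin.last n).succ l.succ * (Fin.snoc v i : Fin (n + 1) → ℤ) l =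
        ∑ l : Fin n, f.1.1 (Fin.last n).succ l.castSucc.succ * v l := fun i => by
      rw [Finset.sum_filter, Fin.sum_univ_castSucc]
      simp only [Fin.castSucc_lt_last, Fin.snoc_castSucc, lt_self_iff_false, if_true, if_false,
        add_zero]
    simp only [Fin.snoc_last, shift, act_eq_add, hsum]
    ring
  | cast k =>
    rw [Fin.snoc_castSucc, act_snoc_castSucc f v j 0 k]
    rfl

theorem shift_one (v : Fin n → ℤ) : shift (1 : lowerUnitriangular (n + 1)) v = 0 := by
  rw [shift, act_one, Fin.snoc_last]

theorem shift_mul (f g : lowerUnitriangular (n + 1)) (v : Fin n → ℤ) :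
    shift (f * g) v = shift f (baseAct g v) + shift g v := by
  have h := act_mul f g (Fin.snoc v 0)
  rw [act_snoc, act_snoc, act_snoc] at h
  simpa only [Fin.snoc_last, zero_add, add_comm (shift f _)] using congrFun h (Fin.last n)

theorem baseAct_lt_baseAct_iff (f : lowerUnitriangular (n + 1)) {v w : Fin n → ℤ} :
    toLex (baseAct f v) < toLex (baseAct f w) ↔ toLex v < toLex w := by
  have key : ∀ (f : lowerUnitriangular (n + 1)) {v w : Fin n → ℤ}, toLex v < toLex w →
      toLex (baseAct f v) < toLex (baseAct f w) := fun f v w h => by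
    have hsnoc := act_lt_act f (toLex_snoc_lt_snoc (j := 0) (k := 0) |>.2 (Or.inl h))
    rw [act_snoc, act_snoc, toLex_snoc_lt_snoc] at hsnoc
    refine hsnoc.resolve_right fun hvw => h.ne ?_
    rw [(baseAct f).injective hvw.1]
  refine ⟨fun h => ?_, key f⟩
  simpa only [map_inv, Equiv.Perm.inv_def, Equiv.symm_apply_apply] using key f⁻¹ h

/-- The lexicographic order on `ℤ^n × T`. -/
def LexLT {T : Type*} [LT T] (p q : (Fin n → ℤ) × T) : Prop :=
  toLex p.1 < toLex q.1 ∨ p.1 = q.1 ∧ p.2 < q.2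

/-- The skew-product action of `N_{n+1}` on `ℤ^n × ℝ`. It permutes the unit intervals
`{v} × [j, j + 1]` in the same way as `N_{n+1}` permutes the indices `(v, j)`. -/
def skew : lowerUnitriangular (n + 1) →* Equiv.Perm ((Fin n → ℤ) × ℝ) :=
  MonoidHom.toHomPerm
    { toFun f p := (baseAct f p.1, p.2 + shift f p.1)
      map_one' := by
        funext p
        simp only [map_one, Equiv.Perm.one_apply, shift_one, Int.cast_zero, add_zero]
        rfl
      map_mul' f g := by
        refine funext fun p => Prod.ext (by rw [map_mul]; rfl) ?_
        change p.2 + (shift (f * g) p.1 : ℝ) = p.2 + shift g p.1 + shift f (baseAct g p.1)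
        rw [shift_mul, Int.cast_add]
        ring }

theorem skew_apply (f : lowerUnitriangular (n + 1)) (v : Fin n → ℤ) (t : ℝ) :
    skew f (v, t) = (baseAct f v, t + shift f v) :=
  rfl

theorem lexLT_skew_iff (f : lowerUnitriangular (n + 1)) (p q : (Fin n → ℤ) × ℝ) :
    LexLT (skew f p) (skew f q) ↔ LexLT p q := by
  refine or_congr (baseAct_lt_baseAct_iff f) ?_
  rw [skew_apply, skew_apply, (baseAct f).injective.eq_iff]
  refine and_congr_right fun h => ?_
  rw [h, add_lt_add_iff_right]

end Skew

section LeftEnd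

variable {d : ℕ} {ℓ : (Fin d → ℤ) → ℝ}

theorem leftEnd_add_eq_tsum (hs : Summable ℓ) (i : Fin d → ℤ) :
    leftEnd ℓ i + ℓ i = ∑' j : {j : Fin d → ℤ | toLex j ≤ toLex i}, ℓ j := by
  have hset : {j : Fin d → ℤ | toLex j ≤ toLex i} = {j | toLex j < toLex i} ∪ {i} := by
    ext j
    exact le_iff_lt_or_eq (a := toLex j) (b := toLex i)
  have hdisj : Disjoint {j : Fin d → ℤ | toLex j < toLex i} {i} :=
    disjoint_singleton_right.2 (lt_irrefl (toLex i))
  rw [hset, (hs.subtype _).tsum_union_disjoint hdisj (hs.subtype _), tsum_singleton]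
  rfl

theorem leftEnd_comp_perm (ℓ : (Fin d → ℤ) → ℝ) {σ : Equiv.Perm (Fin d → ℤ)}
    (hσ : ∀ i j, toLex (σ i) < toLex (σ j) ↔ toLex i < toLex j) (i : Fin d → ℤ) :
    leftEnd (ℓ ∘ σ) i = leftEnd ℓ (σ i) :=
  (σ.subtypeEquiv fun j => (hσ j i).symm).tsum_eq
    fun j : {j : Fin d → ℤ // toLex j < toLex (σ i)} => ℓ j.1

theorem toLex_lt_snoc_add_one {n : ℕ} {i : Fin (n + 1) → ℤ} {v : Fin n → ℤ} {j : ℤ} :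
    toLex i < toLex (Fin.snoc v (j + 1) : Fin (n + 1) → ℤ) ↔
      toLex i ≤ toLex (Fin.snoc v j : Fin (n + 1) → ℤ) := by
  rw [← Fin.snoc_init_self i, toLex_snoc_lt_snoc, le_iff_lt_or_eq, toLex_inj, Fin.snoc_inj,
    Int.lt_add_one_iff, le_iff_lt_or_eq]
  refine Iff.trans ?_ (or_congr_left toLex_snoc_lt_snoc.symm)
  tauto

/-- Lengths of closed intervals `I_i`, `i ∈ ℤ^d`, that tile `[0,1]`. -/
structure IsLengthFunction (ℓ : (Fin d → ℤ) → ℝ) : Prop where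
  pos : ∀ i, 0 < ℓ i
  hasSum : HasSum ℓ 1

namespace IsLengthFunction

theorem leftEnd_nonneg (hℓ : IsLengthFunction ℓ) (i : Fin d → ℤ) : 0 ≤ leftEnd ℓ i :=
  tsum_nonneg fun j => (hℓ.pos j).le

theorem leftEnd_add_le_leftEnd (hℓ : IsLengthFunction ℓ) {i j : Fin d → ℤ}
    (h : toLex i < toLex j) : leftEnd ℓ i + ℓ i ≤ leftEnd ℓ j := by
  have hs := hℓ.hasSum.summable
  have hleft : leftEnd ℓ j = ∑' k : {k : Fin d → ℤ | toLex k < toLex j}, ℓ k := rfl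
  rw [leftEnd_add_eq_tsum hs, hleft, tsum_subtype, tsum_subtype]
  exact (hs.indicator _).tsum_le_tsum
    (indicator_le_indicator_of_subset (fun k hk => lt_of_le_of_lt hk h) fun k => (hℓ.pos k).le)
    (hs.indicator _)

theorem leftEnd_add_le_one (hℓ : IsLengthFunction ℓ) (i : Fin d → ℤ) :
    leftEnd ℓ i + ℓ i ≤ 1 := by
  rw [leftEnd_add_eq_tsum hℓ.hasSum.summable, ← hℓ.hasSum.tsum_eq]
  exact hℓ.hasSum.summable.tsum_subtype_le ℓ _ fun k => (hℓ.pos k).le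

theorem leftEnd_lt_add (hℓ : IsLengthFunction ℓ) (i : Fin d → ℤ) :
    leftEnd ℓ i < leftEnd ℓ i + ℓ i :=
  lt_add_of_pos_right _ (hℓ.pos i)

theorem leftEnd_snoc_add_one {n : ℕ} {ℓ : (Fin (n + 1) → ℤ) → ℝ} (hℓ : IsLengthFunction ℓ)
    (v : Fin n → ℤ) (j : ℤ) :
    leftEnd ℓ (Fin.snoc v (j + 1)) = leftEnd ℓ (Fin.snoc v j) + ℓ (Fin.snoc v j) := by
  rw [leftEnd_add_eq_tsum hℓ.hasSum.summable]
  refine tsum_congr_set_coe ℓ ?_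
  exact ext fun i => toLex_lt_snoc_add_one

theorem pairwise_disjoint_Ioc (hℓ : IsLengthFunction ℓ) :
    Pairwise (Function.onFun Disjoint fun i => Ioc (leftEnd ℓ i) (leftEnd ℓ i + ℓ i)) := by
  have key : ∀ {i j : Fin d → ℤ}, toLex i < toLex j →
      Disjoint (Ioc (leftEnd ℓ i) (leftEnd ℓ i + ℓ i)) (Ioc (leftEnd ℓ j) (leftEnd ℓ j + ℓ j)) :=
    fun h => Set.disjoint_left.2 fun z hz hz' =>
      (hz.2.trans (hℓ.leftEnd_add_le_leftEnd h)).not_gt hz'.1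
  intro i j hij
  rcases lt_or_gt_of_ne (toLex_inj.not.2 hij) with h | h
  · exact key h
  · exact (key h).symm

end IsLengthFunction

end LeftEnd

section Tiling

theorem iUnion_Ioc_ae_eq {ι : Type*} [Countable ι] {x ℓ : ι → ℝ} {L : ℝ} (hℓ : ∀ i, 0 ≤ ℓ i)
    (hL : HasSum ℓ L) (hdisj : Pairwise (Function.onFun Disjoint fun i => Ioc (x i) (x i + ℓ i)))
    (hsub : ∀ i, Ioc (x i) (x i + ℓ i) ⊆ Ioc 0 L) :
    (⋃ i, Ioc (x i) (x i + ℓ i)) =ᵐ[volume] Ioc 0 L := by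
  refine ae_eq_of_subset_of_measure_ge (iUnion_subset hsub) ?_
    (MeasurableSet.iUnion fun i => measurableSet_Ioc).nullMeasurableSet measure_Ioc_lt_top.ne
  rw [measure_iUnion hdisj fun i => measurableSet_Ioc]
  simp only [Real.volume_Ioc, add_sub_cancel_left, sub_zero]
  rw [← ENNReal.ofReal_tsum_of_nonneg hℓ hL.summable, hL.tsum_eq]

variable {d : ℕ} {ℓ : (Fin d → ℤ) → ℝ}

theorem IsLengthFunction.exists_mem_Ioo_inter (hℓ : IsLengthFunction ℓ) {x y : ℝ} (hx : 0 ≤ x)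
    (hy : y ≤ 1) (hxy : x < y) :
    ∃ i, (Ioo x y ∩ Ioo (leftEnd ℓ i) (leftEnd ℓ i + ℓ i)).Nonempty := by
  have hnull : volume (Ioc (0 : ℝ) 1 \ ⋃ i, Ioc (leftEnd ℓ i) (leftEnd ℓ i + ℓ i)) = 0 :=
    ae_le_set.1 (iUnion_Ioc_ae_eq (fun i => (hℓ.pos i).le) hℓ.hasSum hℓ.pairwise_disjoint_Ioc
      fun i => Ioc_subset_Ioc (hℓ.leftEnd_nonneg i) (hℓ.leftEnd_add_le_one i)).symm.le
  obtain ⟨z, hz, hzU⟩ : ∃ z ∈ Ioo x y, z ∈ ⋃ i, Ioc (leftEnd ℓ i) (leftEnd ℓ i + ℓ i) := by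
    by_contra! hcon
    have hsub : Ioo x y ⊆ Ioc (0 : ℝ) 1 \ ⋃ i, Ioc (leftEnd ℓ i) (leftEnd ℓ i + ℓ i) :=
      fun z hz => ⟨⟨hx.trans_lt hz.1, hz.2.le.trans hy⟩, hcon z hz⟩
    have hpos : 0 < volume (Ioo x y) := by
      rw [Real.volume_Ioo]
      exact ENNReal.ofReal_pos.2 (sub_pos.2 hxy)
    exact hpos.ne' (measure_mono_null hsub hnull)
  obtain ⟨i, hi⟩ := mem_iUnion.1 hzU
  obtain ⟨w, hw, hwz⟩ := exists_between (max_lt hz.1 hi.1)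
  exact ⟨i, w, ⟨(le_max_left _ _).trans_lt hw, hwz.trans hz.2⟩,
    (le_max_right _ _).trans_lt hw, hwz.trans_le hi.2⟩

theorem IsLengthFunction.leftEnd_integral (hℓ : IsLengthFunction ℓ) {G : ℝ → ℝ}
    (hG : IntegrableOn G (Ioc 0 1)) (i : Fin d → ℤ) :
    leftEnd (fun j => ∫ x in leftEnd ℓ j..leftEnd ℓ j + ℓ j, G x) i =
      ∫ x in 0..leftEnd ℓ i, G x := by
  let B : {j : Fin d → ℤ // toLex j < toLex i} → Set ℝ :=
    fun j => Ioc (leftEnd ℓ j) (leftEnd ℓ j + ℓ j)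
  have hdisj : Pairwise (Function.onFun Disjoint B) :=
    hℓ.pairwise_disjoint_Ioc.comp_of_injective Subtype.val_injective
  have hsub : ∀ j, B j ⊆ Ioc 0 (leftEnd ℓ i) := fun j =>
    Ioc_subset_Ioc (hℓ.leftEnd_nonneg j) (hℓ.leftEnd_add_le_leftEnd j.2)
  have hunion : (⋃ j, B j) =ᵐ[volume] Ioc 0 (leftEnd ℓ i) :=
    iUnion_Ioc_ae_eq (fun j => (hℓ.pos _).le) (hℓ.hasSum.summable.subtype _).hasSum hdisj hsub
  have hGi : IntegrableOn G (⋃ j, B j) := hG.mono_set <| (iUnion_subset hsub).trans <|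
    Ioc_subset_Ioc_right ((hℓ.leftEnd_lt_add i).le.trans (hℓ.leftEnd_add_le_one i))
  rw [intervalIntegral.integral_of_le (hℓ.leftEnd_nonneg i), ← setIntegral_congr_set hunion,
    ← (hasSum_integral_iUnion (fun j => measurableSet_Ioc) hdisj hGi).tsum_eq]
  exact tsum_congr fun j => intervalIntegral.integral_of_le (hℓ.leftEnd_lt_add _).le

end Tiling

section LexEmbedding

variable {m n : ℕ}

theorem lexLT_trichotomy {T : Type*} [LinearOrder T] (p q : (Fin n → ℤ) × T) :
    LexLT p q ∨ p = q ∨ LexLT q p := by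
  rcases lt_trichotomy (toLex p.1) (toLex q.1) with h | h | h
  · exact Or.inl (Or.inl h)
  · have h1 : p.1 = q.1 := toLex_inj.1 h
    rcases lt_trichotomy p.2 q.2 with h2 | h2 | h2
    · exact Or.inl (Or.inr ⟨h1, h2⟩)
    · exact Or.inr (Or.inl (Prod.ext h1 h2))
    · exact Or.inr (Or.inr (Or.inr ⟨h1.symm, h2⟩))
  · exact Or.inr (Or.inr (Or.inl h))

/-- An embedding of the lexicographically ordered set `ℤ^n × T` onto a dense subset of `[0,1]`.
Orientation-preserving actions on `[0,1]` are built and compared by means of such embeddings. -/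
structure IsLexEmbedding {T : Type*} [LT T] (P : (Fin n → ℤ) × T → unitInterval) : Prop where
  lt_iff : ∀ p q, P p < P q ↔ LexLT p q
  denseRange : DenseRange P

theorem IsLexEmbedding.injective {T : Type*} [LinearOrder T] {P : (Fin n → ℤ) × T → unitInterval}
    (hP : IsLexEmbedding P) : Function.Injective P := fun p q h => by
  rcases lexLT_trichotomy p q with hpq | hpq | hqp
  · exact absurd h ((hP.lt_iff p q).2 hpq).ne
  · exact hpq
  · exact absurd h ((hP.lt_iff q p).2 hqp).ne'

theorem IsLexEmbedding.comp {S T : Type*} [LT S] [LT T] {P : (Fin n → ℤ) × T → unitInterval}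
    (hP : IsLexEmbedding P) {e : (Fin m → ℤ) × S → (Fin n → ℤ) × T}
    (hsurj : Function.Surjective e) (he : ∀ p q, LexLT (e p) (e q) ↔ LexLT p q) :
    IsLexEmbedding (P ∘ e) where
  lt_iff p q := (hP.lt_iff _ _).trans (he p q)
  denseRange := (congrArg Dense (hsurj.range_comp P)).mpr hP.denseRange

theorem IsLexEmbedding.exists_skew_extension {P : (Fin n → ℤ) × ℝ → unitInterval}
    (hP : IsLexEmbedding P) : ∃ φ : lowerUnitriangular (n + 1) →* (unitInterval ≃ₜ unitInterval),
      (∀ f, StrictMono (φ f)) ∧ ∀ f p, φ f (P p) = P (skew f p) :=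
  exists_hom_homeomorph_extending hP.denseRange skew fun f p q => by
    rw [hP.lt_iff, hP.lt_iff, lexLT_skew_iff]

theorem IsLengthFunction.isLexEmbedding {T : Type*} [LinearOrder T] {ℓ : (Fin n → ℤ) → ℝ}
    (hℓ : IsLengthFunction ℓ) {P : (Fin n → ℤ) × T → unitInterval}
    (hmono : ∀ v, StrictMono fun t => P (v, t))
    (hmem : ∀ v t, (P (v, t) : ℝ) ∈ Ico (leftEnd ℓ v) (leftEnd ℓ v + ℓ v))
    (hsurj : ∀ v (x : unitInterval), (x : ℝ) ∈ Ioo (leftEnd ℓ v) (leftEnd ℓ v + ℓ v) →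
      ∃ t, P (v, t) = x) : IsLexEmbedding P := by
  have hlt : ∀ p q, LexLT p q → P p < P q := by
    rintro ⟨v, t⟩ ⟨w, u⟩ (h | ⟨rfl, h⟩)
    · exact Subtype.coe_lt_coe.1
        ((hmem v t).2.trans_le ((hℓ.leftEnd_add_le_leftEnd h).trans (hmem w u).1))
    · exact hmono v h
  refine ⟨fun p q => ⟨fun h => ?_, hlt p q⟩, dense_of_exists_between fun x y hxy => ?_⟩
  · rcases lexLT_trichotomy p q with hpq | rfl | hqp
    · exact hpq
    · exact absurd h (lt_irrefl _)
    · exact absurd h (hlt q p hqp).not_gt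
  · obtain ⟨v, z, hz, hzv⟩ := hℓ.exists_mem_Ioo_inter x.2.1 y.2.2 hxy
    obtain ⟨t, ht⟩ := hsurj v ⟨z, x.2.1.trans hz.1.le, hz.2.le.trans y.2.2⟩ hzv
    exact ⟨P (v, t), mem_range_self _, by rw [ht]; exact hz.1, by rw [ht]; exact hz.2⟩

theorem IsLengthFunction.isLexEmbedding_of_range_eq_block {ℓ : (Fin n → ℤ) → ℝ}
    (hℓ : IsLengthFunction ℓ) {R : (Fin n → ℤ) → unitInterval → unitInterval}
    (hmono : ∀ v, StrictMono (R v)) (hrange : ∀ v, range (R v) = block ℓ v) :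
    IsLexEmbedding fun p : (Fin n → ℤ) × Iio (1 : unitInterval) => R p.1 p.2 := by
  have hblock : ∀ v s, R v s ∈ block ℓ v := fun v s => hrange v ▸ mem_range_self s
  refine hℓ.isLexEmbedding (fun v s s' h => hmono v h) (fun v s => ⟨(hblock v s).1, ?_⟩)
    fun v x hx => ?_
  · exact lt_of_lt_of_le (hmono v s.2) (hblock v 1).2
  · obtain ⟨s, rfl⟩ : x ∈ range (R v) := hrange v ▸ ⟨hx.1.le, hx.2.le⟩
    have hend : leftEnd ℓ v + ℓ v ∈ Icc (0 : ℝ) 1 :=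
      ⟨(hℓ.leftEnd_nonneg v).trans (hℓ.leftEnd_lt_add v).le, hℓ.leftEnd_add_le_one v⟩
    obtain ⟨s', hs'⟩ : (⟨_, hend⟩ : unitInterval) ∈ range (R v) :=
      hrange v ▸ ⟨(hℓ.leftEnd_lt_add v).le, le_rfl⟩
    have hlt : R v s < R v s' := hs'.symm ▸ hx.2
    exact ⟨⟨s, ((hmono v).lt_iff_lt.1 hlt).trans_le s'.2.2⟩, rfl⟩

theorem lt_iff_floor_lt_or_fract_lt {t u : ℝ} :
    t < u ↔ ⌊t⌋ < ⌊u⌋ ∨ ⌊t⌋ = ⌊u⌋ ∧ Int.fract t < Int.fract u := by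
  constructor
  · intro h
    rcases (Int.floor_mono h.le).lt_or_eq with hlt | heq
    · exact Or.inl hlt
    · refine Or.inr ⟨heq, ?_⟩
      rwa [Int.fract, Int.fract, heq, sub_lt_sub_iff_right]
  · rintro (h | ⟨heq, h⟩)
    · exact Int.floor_mono.reflect_lt h
    · rwa [Int.fract, Int.fract, heq, sub_lt_sub_iff_right] at h

/-- The identification of `ℤ^n × ℝ` with `ℤ^{n+1} × [0, 1)` given by the integer and fractional
parts of the real coordinate. -/
noncomputable def floorSplit (p : (Fin n → ℤ) × ℝ) : (Fin (n + 1) → ℤ) × Iio (1 : unitInterval) :=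
  (Fin.snoc p.1 ⌊p.2⌋, ⟨⟨Int.fract p.2, Int.fract_nonneg _, (Int.fract_lt_one _).le⟩,
    Int.fract_lt_one p.2⟩)

theorem floorSplit_intCast_add (v : Fin n → ℤ) (j : ℤ) (s : Iio (1 : unitInterval)) :
    floorSplit (v, j + (s.1 : ℝ)) = (Fin.snoc v j, s) := by
  have hs : ((s : unitInterval) : ℝ) ∈ Ico (0 : ℝ) 1 := ⟨s.1.2.1, s.2⟩
  refine Prod.ext ?_ (Subtype.ext (Subtype.ext ?_))
  · simp only [floorSplit, Int.floor_intCast_add, Int.floor_eq_zero_iff.2 hs, add_zero]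
  · simp only [floorSplit, Int.fract_intCast_add, Int.fract_eq_self.2 hs]

theorem floorSplit_surjective : Function.Surjective (floorSplit (n := n)) := by
  rintro ⟨i, s⟩
  exact ⟨_, (floorSplit_intCast_add _ _ s).trans (Prod.ext (Fin.snoc_init_self i) rfl)⟩

theorem lexLT_floorSplit_iff (p q : (Fin n → ℤ) × ℝ) :
    LexLT (floorSplit p) (floorSplit q) ↔ LexLT p q := by
  have hfract : (floorSplit p).2 < (floorSplit q).2 ↔ Int.fract p.2 < Int.fract q.2 := Iff.rfl
  rw [LexLT, LexLT, hfract, lt_iff_floor_lt_or_fract_lt (t := p.2)]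
  simp only [floorSplit, toLex_snoc_lt_snoc, Fin.snoc_inj]
  tauto

theorem floorSplit_skew (f : lowerUnitriangular (n + 1)) (p : (Fin n → ℤ) × ℝ) :
    floorSplit (skew f p) = (act f (floorSplit p).1, (floorSplit p).2) := by
  simp only [floorSplit, skew_apply f p.1 p.2, Int.floor_add_intCast, Int.fract_add_intCast,
    act_snoc]

end LexEmbedding

section FarbFranksActions

variable {d n : ℕ}

/-- The point dividing the interval `I_i` in the ratio `s : 1 - s`. -/
noncomputable def blockPoint {ℓ : (Fin d → ℤ) → ℝ} (hℓ : IsLengthFunction ℓ) (i : Fin d → ℤ)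
    (s : unitInterval) : unitInterval :=
  ⟨leftEnd ℓ i + s * ℓ i, add_nonneg (hℓ.leftEnd_nonneg i) (mul_nonneg s.2.1 (hℓ.pos i).le),
    (add_le_add_right (mul_le_of_le_one_left (hℓ.pos i).le s.2.2) _).trans
      (hℓ.leftEnd_add_le_one i)⟩

theorem strictMono_blockPoint {ℓ : (Fin d → ℤ) → ℝ} (hℓ : IsLengthFunction ℓ) (i : Fin d → ℤ) :
    StrictMono (blockPoint hℓ i) := fun _ _ h =>
  Subtype.coe_lt_coe.1 (by
    change _ + _ < _ + _
    gcongr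
    exact hℓ.pos i)

theorem range_blockPoint {ℓ : (Fin d → ℤ) → ℝ} (hℓ : IsLengthFunction ℓ) (i : Fin d → ℤ) :
    range (blockPoint hℓ i) = block ℓ i := by
  have hpos := hℓ.pos i
  ext x
  constructor
  · rintro ⟨s, rfl⟩
    exact ⟨le_add_of_nonneg_right (mul_nonneg s.2.1 hpos.le),
      add_le_add_right (mul_le_of_le_one_left hpos.le s.2.2) _⟩
  · rintro ⟨h0, h1⟩
    refine ⟨⟨(x - leftEnd ℓ i) / ℓ i, div_nonneg (sub_nonneg.2 h0) hpos.le,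
      (div_le_one hpos).2 (by linarith)⟩, Subtype.ext ?_⟩
    simp only [blockPoint, div_mul_cancel₀ _ hpos.ne', add_sub_cancel]

theorem block_eq_Icc {ℓ : (Fin d → ℤ) → ℝ} (hℓ : IsLengthFunction ℓ) (i : Fin d → ℤ) :
    block ℓ i = Icc (blockPoint hℓ i 0) (blockPoint hℓ i 1) := by
  ext x
  simp only [block, mem_ofPred_eq, mem_Icc, ← Subtype.coe_le_coe, blockPoint, Icc.coe_zero,
    Icc.coe_one, zero_mul, one_mul, add_zero]

theorem IsFarbFranksAction.exists_isLexEmbedding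
    {φ : lowerUnitriangular (n + 1) →* (unitInterval ≃ₜ unitInterval)}
    (hφ : IsFarbFranksAction (n + 1) φ) :
    ∃ P : (Fin n → ℤ) × ℝ → unitInterval, IsLexEmbedding P ∧ ∀ f p, φ f (P p) = P (skew f p) := by
  obtain ⟨hmono, ℓ, hpos, hsum, himage, hequiv⟩ := hφ
  have hℓ : IsLengthFunction ℓ := ⟨hpos, hsum⟩
  choose g hg using exists_act_zero_eq (d := n + 1)
  let R : (Fin (n + 1) → ℤ) → unitInterval → unitInterval :=
    fun i s => φ (g i) (blockPoint hℓ 0 s)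
  have hR : ∀ i, range (R i) = block ℓ i := fun i => by
    change range (φ (g i) ∘ blockPoint hℓ 0) = _
    rw [range_comp, range_blockPoint, himage, hg]
  have hRφ : ∀ f i s, φ f (R i s) = R (act f i) s := fun f i s => by
    have hact : act (f * g i) 0 = act (g (act f i)) 0 := by rw [act_mul, hg, hg]
    have hs : blockPoint hℓ 0 s ∈ block ℓ 0 := range_blockPoint hℓ 0 ▸ mem_range_self s
    change (φ f * φ (g i)) (blockPoint hℓ 0 s) = _
    rw [← map_mul]
    exact hequiv _ _ _ hact hs
  refine ⟨_, (hℓ.isLexEmbedding_of_range_eq_block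
    (fun i => (hmono (g i)).comp (strictMono_blockPoint hℓ 0)) hR).comp floorSplit_surjective
      lexLT_floorSplit_iff, fun f p => ?_⟩
  simp only [Function.comp_apply, floorSplit_skew]
  exact hRφ f _ _

theorem IsFarbFranksAction.exists_conjugate
    {φ : lowerUnitriangular (n + 1) →* (unitInterval ≃ₜ unitInterval)}
    (hφ : IsFarbFranksAction (n + 1) φ) {Q : (Fin n → ℤ) × ℝ → unitInterval}
    (hQ : IsLexEmbedding Q) : ∃ ψ : lowerUnitriangular (n + 1) →* (unitInterval ≃ₜ unitInterval),
      (∀ f p, ψ f (Q p) = Q (skew f p)) ∧ TopConj φ ψ := by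
  obtain ⟨P, hP, hφP⟩ := hφ.exists_isLexEmbedding
  obtain ⟨ψ, -, hψQ⟩ := hQ.exists_skew_extension
  refine ⟨ψ, hψQ, topConj_of_denseRange hP.denseRange hQ.denseRange (fun p q => ?_) hφP hψQ⟩
  rw [hP.lt_iff, hQ.lt_iff]

theorem exists_isLengthFunction_mul {w : (Fin d → ℤ) → ℝ} (hpos : ∀ i, 0 < w i)
    (hw : Summable w) : ∃ ζ > 0, IsLengthFunction fun i => ζ * w i := by
  have hsum : 0 < ∑' i, w i := hw.tsum_pos (fun i => (hpos i).le) 0 (hpos 0)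
  refine ⟨(∑' i, w i)⁻¹, inv_pos.2 hsum, fun i => mul_pos (inv_pos.2 hsum) (hpos i), ?_⟩
  simpa only [inv_mul_cancel₀ hsum.ne'] using hw.hasSum.mul_left (∑' i, w i)⁻¹

section AffineChart

variable {ℓ : (Fin (n + 1) → ℤ) → ℝ} (hℓ : IsLengthFunction ℓ)

/-- The embedding of `ℤ^n × ℝ` into `[0,1]` mapping each `{v} × [j, j + 1]` affinely onto the
interval `I_{(v, j)}`. -/
noncomputable def affineChart (p : (Fin n → ℤ) × ℝ) : unitInterval :=
  blockPoint hℓ (floorSplit p).1 (floorSplit p).2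

theorem isLexEmbedding_affineChart : IsLexEmbedding (affineChart hℓ) :=
  (hℓ.isLexEmbedding_of_range_eq_block (strictMono_blockPoint hℓ) (range_blockPoint hℓ)).comp
    floorSplit_surjective lexLT_floorSplit_iff

theorem affineChart_intCast_add (v : Fin n → ℤ) (j : ℤ) {s : unitInterval} (hs : s < 1) :
    affineChart hℓ (v, j + (s : ℝ)) = blockPoint hℓ (Fin.snoc v j) s :=
  congrArg (fun q : (Fin (n + 1) → ℤ) × Iio (1 : unitInterval) => blockPoint hℓ q.1 q.2)
    (floorSplit_intCast_add v j ⟨s, hs⟩)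

theorem affineChart_intCast (v : Fin n → ℤ) (j : ℤ) :
    affineChart hℓ (v, j) = blockPoint hℓ (Fin.snoc v j) 0 := by
  simpa only [Icc.coe_zero, add_zero] using affineChart_intCast_add hℓ v j zero_lt_one

theorem affineChart_intCast_add_one (v : Fin n → ℤ) (j : ℤ) :
    affineChart hℓ (v, j + 1) = blockPoint hℓ (Fin.snoc v j) 1 := by
  rw [← Int.cast_one, ← Int.cast_add, affineChart_intCast]
  refine Subtype.ext ?_
  simp only [blockPoint, hℓ.leftEnd_snoc_add_one, Icc.coe_zero, Icc.coe_one, zero_mul, one_mul,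
    add_zero]

theorem block_snoc_eq_Icc (v : Fin n → ℤ) (j : ℤ) :
    block ℓ (Fin.snoc v j) = Icc (affineChart hℓ (v, j)) (affineChart hℓ (v, j + 1)) := by
  rw [affineChart_intCast, affineChart_intCast_add_one, block_eq_Icc hℓ]

theorem exists_affineChart_eq {v : Fin n → ℤ} {j : ℤ} {x : unitInterval}
    (hx : x ∈ block ℓ (Fin.snoc v j)) : ∃ t, affineChart hℓ (v, t) = x := by
  obtain ⟨s, rfl⟩ := range_blockPoint hℓ _ ▸ hx
  rcases s.2.2.lt_or_eq with hs | hs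
  · exact ⟨j + s, affineChart_intCast_add hℓ v j hs⟩
  · exact ⟨j + 1, by rw [affineChart_intCast_add_one, Subtype.ext (a1 := s) (a2 := 1) hs]⟩

end AffineChart

theorem exists_isFarbFranksAction (n : ℕ) :
    ∃ φ : lowerUnitriangular (n + 1) →* (unitInterval ≃ₜ unitInterval),
      IsFarbFranksAction (n + 1) φ := by
  obtain ⟨w, hw, c, hc, -⟩ := posSumOfEncodable one_pos (Fin (n + 1) → ℤ)
  obtain ⟨ζ, -, hℓ⟩ := exists_isLengthFunction_mul hw hc.summable
  obtain ⟨φ, hmono, hφ⟩ := (isLexEmbedding_affineChart hℓ).exists_skew_extension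
  refine ⟨φ, hmono, _, hℓ.pos, hℓ.hasSum, fun f i => ?_, fun f g i hfg x hx => ?_⟩
  · have hIcc : ∀ a b, φ f '' Icc a b = Icc (φ f a) (φ f b) :=
      ((hmono f).orderIsoOfSurjective _ (φ f).surjective).image_Icc
    rw [← Fin.snoc_init_self i, act_snoc, block_snoc_eq_Icc hℓ, block_snoc_eq_Icc hℓ, hIcc, hφ, hφ,
      skew_apply, skew_apply, Int.cast_add, add_right_comm (_ : ℝ) 1]
  · rw [← Fin.snoc_init_self i] at hx hfg
    obtain ⟨t, rfl⟩ := exists_affineChart_eq hℓ hx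
    rw [act_snoc, act_snoc, Fin.snoc_inj, add_right_inj] at hfg
    rw [hφ, hφ, skew_apply, skew_apply, hfg.1, hfg.2]

end FarbFranksActions

section HolderExtension

variable {ι : Type*} {Q : ι × ℝ → unitInterval} {D : ι × ℝ → ℝ} {α M : ℝ}

theorem abs_sub_one_le_of_notMem_range (hα : 0 < α) (hM : 0 ≤ M)
    (hmono : ∀ v, StrictMono fun t => Q (v, t)) (hcont : ∀ v, Continuous fun t => Q (v, t))
    (hD : ∀ v s t, |D (v, s) - D (v, t)| ≤ M * |(Q (v, s) : ℝ) - Q (v, t)| ^ α)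
    (hlim : ∀ v, Tendsto (fun t => D (v, t)) (cocompact ℝ) (𝓝 1)) (v : ι) (t : ℝ) {y : unitInterval}
    (hy : y ∉ range fun s => Q (v, s)) :
    |D (v, t) - 1| ≤ M * |(Q (v, t) : ℝ) - y| ^ α := by
  have hside : (∀ s, Q (v, s) < y) ∨ ∀ s, y < Q (v, s) := by
    by_contra! hcon
    obtain ⟨⟨a, ha⟩, b, hb⟩ := hcon
    exact hy (mem_range_of_exists_le_of_exists_ge (hcont v) ⟨b, hb⟩ ⟨a, ha⟩)
  rcases hside with h | h
  · refine le_of_tendsto ((tendsto_const_nhds.sub ((hlim v).mono_left atTop_le_cocompact)).abs) ?_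
    filter_upwards [eventually_ge_atTop t] with s hs
    have hts : (Q (v, t) : ℝ) ≤ Q (v, s) := (hmono v).monotone hs
    have hsy : (Q (v, s) : ℝ) < y := h s
    refine (hD v t s).trans ?_
    gcongr M * ?_ ^ α
    rw [abs_of_nonpos (by linarith), abs_of_nonpos (by linarith)]
    linarith
  · refine le_of_tendsto ((tendsto_const_nhds.sub ((hlim v).mono_left atBot_le_cocompact)).abs) ?_
    filter_upwards [eventually_le_atBot t] with s hs
    have hst : (Q (v, s) : ℝ) ≤ Q (v, t) := (hmono v).monotone hs
    have hys : (y : ℝ) < Q (v, s) := h s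
    refine (hD v t s).trans ?_
    gcongr M * ?_ ^ α
    rw [abs_of_nonneg (by linarith), abs_of_nonneg (by linarith)]
    linarith

theorem exists_holder_extension (hα : 0 < α) (hM : 0 ≤ M) (hinj : Function.Injective Q)
    (hmono : ∀ v, StrictMono fun t => Q (v, t)) (hcont : ∀ v, Continuous fun t => Q (v, t))
    (hpos : ∀ p, 0 < D p)
    (hD : ∀ v s t, |D (v, s) - D (v, t)| ≤ M * |(Q (v, s) : ℝ) - Q (v, t)| ^ α)
    (hlim : ∀ v, Tendsto (fun t => D (v, t)) (cocompact ℝ) (𝓝 1)) :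
    ∃ G : unitInterval → ℝ, (∀ p, G (Q p) = D p) ∧ (∀ y, 0 < G y) ∧
      ∀ x y : unitInterval, |G x - G y| ≤ 2 * M * |(x : ℝ) - y| ^ α := by
  let G : unitInterval → ℝ := Function.extend Q D fun _ => 1
  have hG : ∀ p, G (Q p) = D p := fun p => hinj.extend_apply D _ p
  have hG1 : ∀ y, y ∉ range Q → G y = 1 := fun y hy => Function.extend_apply' D _ y hy
  have hfibre : ∀ v s t, |G (Q (v, s)) - G (Q (v, t))| ≤
      2 * M * |(Q (v, s) : ℝ) - Q (v, t)| ^ α := fun v s t => by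
    rw [hG, hG]
    refine (hD v s t).trans ?_
    gcongr
    linarith
  have key : ∀ x y : unitInterval, (∃ v s t, x = Q (v, s) ∧ y = Q (v, t)) ∨
      |G x - 1| ≤ M * |(x : ℝ) - y| ^ α := fun x y => by
    by_cases hx : x ∈ range Q
    · obtain ⟨⟨v, s⟩, rfl⟩ := hx
      by_cases hy : y ∈ range fun t => Q (v, t)
      · obtain ⟨t, rfl⟩ := hy
        exact Or.inl ⟨v, s, t, rfl, rfl⟩
      · rw [hG]
        exact Or.inr (abs_sub_one_le_of_notMem_range hα hM hmono hcont hD hlim v s hy)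
    · rw [hG1 x hx, sub_self, abs_zero]
      exact Or.inr (by positivity)
  refine ⟨G, hG, fun y => ?_, fun x y => ?_⟩
  · by_cases hy : y ∈ range Q
    · obtain ⟨p, rfl⟩ := hy
      exact (hpos p).trans_eq (hG p).symm
    · exact one_pos.trans_eq (hG1 y hy).symm
  · rcases key x y with ⟨v, s, t, rfl, rfl⟩ | hx
    · exact hfibre v s t
    rcases key y x with ⟨v, t, s, rfl, rfl⟩ | hy
    · exact hfibre v s t
    rw [abs_sub_comm (y : ℝ)] at hy
    rw [abs_sub_comm] at hy
    linarith [abs_sub_le (G x) 1 (G y)]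

theorem continuous_of_abs_sub_le_rpow {G : unitInterval → ℝ} (hα : 0 < α)
    (hG : ∀ x y : unitInterval, |G x - G y| ≤ M * |(x : ℝ) - y| ^ α) : Continuous G := by
  refine continuous_iff_continuousAt.2 fun y => tendsto_iff_dist_tendsto_zero.2 ?_
  have hlim : Tendsto (fun x : unitInterval => M * |(x : ℝ) - y| ^ α) (𝓝 y) (𝓝 0) := by
    have hcont : Continuous fun x : unitInterval => M * |(x : ℝ) - y| ^ α :=
      ((continuous_subtype_val.sub continuous_const).abs.rpow_const
        fun _ => Or.inr hα.le).const_mul M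
    simpa only [sub_self, abs_zero, Real.zero_rpow hα.ne', mul_zero] using hcont.tendsto y
  exact squeeze_zero (fun _ => dist_nonneg) (fun x => hG x y) hlim

theorem isC1HolderDiffeo_of_eq_integral {h : unitInterval ≃ₜ unitInterval} {G : unitInterval → ℝ}
    (hα : 0 < α) (hpos : ∀ x, 0 < G x)
    (hG : ∀ x y : unitInterval, |G x - G y| ≤ M * |(x : ℝ) - y| ^ α)
    (hh : ∀ y : unitInterval, (h y : ℝ) = ∫ x in 0..y, IccExtend zero_le_one G x) :
    IsC1HolderDiffeo α h := by
  have hcont : Continuous (IccExtend (zero_le_one (α := ℝ)) G) :=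
    (continuous_of_abs_sub_le_rpow hα hG).Icc_extend'
  refine ⟨G, fun x => ⟨hpos x, ?_⟩, M, hG⟩
  have hderiv := (hcont.integral_hasStrictDerivAt 0 (x : ℝ)).hasDerivAt.hasDerivWithinAt
    (s := Icc (0 : ℝ) 1)
  rw [IccExtend_val] at hderiv
  refine hderiv.congr_of_mem (fun t ht => ?_) x.2
  rw [hh, projIcc_of_mem _ ht]

end HolderExtension

section FilledBlocks

variable {n : ℕ} {ℓ : (Fin n → ℤ) → ℝ} {q : (Fin n → ℤ) × ℝ → ℝ}

/-- `Q` maps each line `{v} × ℝ` homeomorphically and increasingly onto the interior of `I_v`. -/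
structure FillsBlocks (ℓ : (Fin n → ℤ) → ℝ) (Q : (Fin n → ℤ) × ℝ → unitInterval) : Prop where
  strictMono : ∀ v, StrictMono fun t => Q (v, t)
  continuous : ∀ v, Continuous fun t => Q (v, t)
  tendsto_atBot : ∀ v, Tendsto (fun t => (Q (v, t) : ℝ)) atBot (𝓝 (leftEnd ℓ v))
  tendsto_atTop : ∀ v, Tendsto (fun t => (Q (v, t) : ℝ)) atTop (𝓝 (leftEnd ℓ v + ℓ v))

namespace FillsBlocks

variable {Q : (Fin n → ℤ) × ℝ → unitInterval}

theorem mem_Ioo (hQ : FillsBlocks ℓ Q) (v : Fin n → ℤ) (t : ℝ) :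
    (Q (v, t) : ℝ) ∈ Ioo (leftEnd ℓ v) (leftEnd ℓ v + ℓ v) := by
  have hmono : StrictMono fun t => (Q (v, t) : ℝ) := hQ.strictMono v
  exact ⟨(hmono.monotone.le_of_tendsto (hQ.tendsto_atBot v) (t - 1)).trans_lt
      (hmono (sub_one_lt t)),
    (hmono (lt_add_one t)).trans_le (hmono.monotone.ge_of_tendsto (hQ.tendsto_atTop v) (t + 1))⟩

theorem isLexEmbedding (hQ : FillsBlocks ℓ Q) (hℓ : IsLengthFunction ℓ) : IsLexEmbedding Q := by
  refine hℓ.isLexEmbedding hQ.strictMono (fun v t => Ioo_subset_Ico_self (hQ.mem_Ioo v t))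
    fun v x hx => ?_
  obtain ⟨s, hs⟩ := ((hQ.tendsto_atBot v).eventually_lt_const hx.1).exists
  obtain ⟨t, ht⟩ := ((hQ.tendsto_atTop v).eventually_const_lt hx.2).exists
  exact mem_range_of_exists_le_of_exists_ge (hQ.continuous v) ⟨s, hs.le⟩ ⟨t, ht.le⟩

theorem exists_const_eq_sub (hQ : FillsBlocks ℓ Q)
    (hq : ∀ v t, HasDerivAt (fun t => (Q (v, t) : ℝ)) (q (v, t)) t) {F G : ℝ → ℝ}
    (hF : ∀ x, HasDerivAt F (G x) x) {v w : Fin n → ℤ} {c : ℝ}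
    (hG : ∀ t, G (Q (v, t)) * q (v, t) = q (w, t + c)) :
    ∃ κ, (∀ t, (Q (w, t + c) : ℝ) - F (Q (v, t)) = κ) ∧ leftEnd ℓ w - F (leftEnd ℓ v) = κ ∧
      leftEnd ℓ w + ℓ w - F (leftEnd ℓ v + ℓ v) = κ := by
  have hderiv : ∀ t, HasDerivAt (fun t => (Q (w, t + c) : ℝ) - F (Q (v, t))) 0 t := fun t => by
    have hdiff := ((hq w (t + c)).comp_add_const t c).sub ((hF (Q (v, t))).comp t (hq v t))
    rwa [hG, sub_self] at hdiff
  have hconst : ∀ t, (Q (w, t + c) : ℝ) - F (Q (v, t)) = Q (w, 0 + c) - F (Q (v, 0)) := fun t =>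
    is_const_of_deriv_eq_zero (fun t => (hderiv t).differentiableAt) (fun t => (hderiv t).deriv) t 0
  have hFcont : Continuous F := continuous_iff_continuousAt.2 fun x => (hF x).continuousAt
  have hlim : ∀ {l : Filter ℝ} [l.NeBot] {a b : ℝ}, Tendsto (fun t => t + c) l l →
      Tendsto (fun t => (Q (w, t) : ℝ)) l (𝓝 a) → Tendsto (fun t => (Q (v, t) : ℝ)) l (𝓝 b) →
      a - F b = Q (w, 0 + c) - F (Q (v, 0)) := fun hl ha hb =>
    tendsto_nhds_unique (((ha.comp hl).sub ((hFcont.tendsto _).comp hb)).congr hconst)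
      tendsto_const_nhds
  exact ⟨_, hconst,
    hlim (tendsto_atBot_add_const_right _ c tendsto_id) (hQ.tendsto_atBot w) (hQ.tendsto_atBot v),
    hlim (tendsto_atTop_add_const_right _ c tendsto_id) (hQ.tendsto_atTop w) (hQ.tendsto_atTop v)⟩

variable {σ : Equiv.Perm (Fin n → ℤ)} {c : (Fin n → ℤ) → ℝ}

theorem coe_eq_integral (hQ : FillsBlocks ℓ Q) (hℓ : IsLengthFunction ℓ)
    (hq : ∀ v t, HasDerivAt (fun t => (Q (v, t) : ℝ)) (q (v, t)) t)
    (hσ : ∀ v w, toLex (σ v) < toLex (σ w) ↔ toLex v < toLex w) {h : unitInterval → unitInterval}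
    (hcont : Continuous h) (hh : ∀ v t, h (Q (v, t)) = Q (σ v, t + c v)) {G : unitInterval → ℝ}
    (hG : Continuous G) (hGq : ∀ v t, G (Q (v, t)) * q (v, t) = q (σ v, t + c v))
    (y : unitInterval) : (h y : ℝ) = ∫ x in 0..y, IccExtend zero_le_one G x := by
  set E : ℝ → ℝ := IccExtend zero_le_one G with hE
  have hEcont : Continuous E := hG.Icc_extend'
  have hEint : ∀ a b, IntervalIntegrable E volume a b := hEcont.intervalIntegrable
  have hF : ∀ x, HasDerivAt (fun x => ∫ u in 0..x, E u) (E x) x := fun x =>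
    (hEcont.integral_hasStrictDerivAt 0 x).hasDerivAt
  choose κ hκ hκleft hκright using fun v => hQ.exists_const_eq_sub hq hF
    (fun t => by rw [hE, IccExtend_val]; exact hGq v t)
  have hblock : ∀ v, ∫ x in leftEnd ℓ v..leftEnd ℓ v + ℓ v, E x = (ℓ ∘ σ) v := fun v => by
    rw [← intervalIntegral.integral_interval_sub_left (hEint 0 _) (hEint 0 _), Function.comp_apply]
    linarith [hκleft v, hκright v]
  have hκzero : ∀ v, κ v = 0 := fun v => by
    rw [← hκleft v, ← hℓ.leftEnd_integral (hEint 0 1).1,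
      funext hblock, leftEnd_comp_perm ℓ hσ, sub_self]
  have hFcont : Continuous fun y : unitInterval => ∫ u in 0..(y : ℝ), E u :=
    (continuous_iff_continuousAt.2 fun x => (hF x).continuousAt).comp continuous_subtype_val
  refine congrFun ((hQ.isLexEmbedding hℓ).denseRange.equalizer
    (continuous_subtype_val.comp hcont) hFcont (funext fun p => ?_)) y
  simp only [Function.comp_apply, hh p.1 p.2]
  rw [← sub_eq_zero, hκ, hκzero]

theorem isC1HolderDiffeo (hQ : FillsBlocks ℓ Q) (hℓ : IsLengthFunction ℓ)
    (hq : ∀ v t, HasDerivAt (fun t => (Q (v, t) : ℝ)) (q (v, t)) t)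
    (hσ : ∀ v w, toLex (σ v) < toLex (σ w) ↔ toLex v < toLex w) {h : unitInterval ≃ₜ unitInterval}
    (hh : ∀ v t, h (Q (v, t)) = Q (σ v, t + c v)) {α M : ℝ} (hα : 0 < α) (hM : 0 ≤ M)
    {D : (Fin n → ℤ) × ℝ → ℝ} (hDpos : ∀ p, 0 < D p)
    (hDq : ∀ v t, D (v, t) * q (v, t) = q (σ v, t + c v))
    (hD : ∀ v s t, |D (v, s) - D (v, t)| ≤ M * |(Q (v, s) : ℝ) - Q (v, t)| ^ α)
    (hlim : ∀ v, Tendsto (fun t => D (v, t)) (cocompact ℝ) (𝓝 1)) : IsC1HolderDiffeo α h := by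
  have hQlex := hQ.isLexEmbedding hℓ
  obtain ⟨G, hGD, hGpos, hGholder⟩ := exists_holder_extension hα hM hQlex.injective
    hQ.strictMono hQ.continuous hDpos hD hlim
  refine isC1HolderDiffeo_of_eq_integral hα hGpos hGholder
    (hQ.coe_eq_integral hℓ hq hσ h.continuous hh (continuous_of_abs_sub_le_rpow hα hGholder) ?_)
  intro v t
  rw [hGD, hDq]

end FillsBlocks

end FilledBlocks

section Sigmoid

theorem abs_le_norm_mk_right (x b : ℝ) : |b| ≤ ‖(⟨x, b⟩ : ℂ)‖ := Complex.abs_im_le_norm ⟨x, b⟩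

theorem norm_mk_pos {b : ℝ} (hb : b ≠ 0) (x : ℝ) : 0 < ‖(⟨x, b⟩ : ℂ)‖ :=
  (abs_pos.2 hb).trans_le (abs_le_norm_mk_right x b)

theorem norm_mk_div {a : ℝ} (ha : 0 < a) (t : ℝ) :
    ‖(⟨t / a, 1⟩ : ℂ)‖ = ‖(⟨t, a⟩ : ℂ)‖ / a := by
  have hmk : (⟨t / a, 1⟩ : ℂ) = ⟨t, a⟩ / (a : ℂ) := by
    apply Complex.ext <;> simp [ha.ne']
  rw [hmk, norm_div, Complex.norm_of_nonneg ha.le]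

theorem hasDerivAt_mk (x b : ℝ) : HasDerivAt (fun x : ℝ => (⟨x, b⟩ : ℂ)) 1 x := by
  simp only [Complex.mk_eq_add_mul_I]
  exact (Complex.ofRealCLM.hasDerivAt (x := x)).add_const _

theorem continuous_norm_mk_rpow {b : ℝ} (hb : b ≠ 0) (r : ℝ) :
    Continuous fun x : ℝ => ‖(⟨x, b⟩ : ℂ)‖ ^ r :=
  (continuous_iff_continuousAt.2 fun x => (hasDerivAt_mk x b).continuousAt).norm.rpow_const
    fun x => Or.inl (norm_mk_pos hb x).ne'

theorem integrable_norm_mk_one_rpow {p : ℝ} (hp : 1 < p) :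
    Integrable fun x : ℝ => ‖(⟨x, 1⟩ : ℂ)‖ ^ (-p) := by
  have hint := integrable_rpow_neg_one_add_norm_sq (E := ℝ) (μ := volume) (r := p)
    (by simpa using hp)
  refine hint.congr (ae_of_all _ fun x => ?_)
  dsimp only
  rw [Complex.norm_eq_sqrt_sq_add_sq, Real.sqrt_eq_rpow, ← Real.rpow_mul (by positivity),
    Real.norm_eq_abs, sq_abs, one_pow, add_comm]
  congr 1
  ring

/-- `S` is the distribution function of the probability density `κ ‖x + i‖ ^ (-p)` on `ℝ`. -/
structure IsSigmoid (p κ : ℝ) (S : ℝ → unitInterval) : Prop where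
  pos : 0 < κ
  hasDerivAt : ∀ x, HasDerivAt (fun x => (S x : ℝ)) (κ * ‖(⟨x, 1⟩ : ℂ)‖ ^ (-p)) x
  tendsto_atBot : Tendsto (fun x => (S x : ℝ)) atBot (𝓝 0)
  tendsto_atTop : Tendsto (fun x => (S x : ℝ)) atTop (𝓝 1)

theorem exists_isSigmoid {p : ℝ} (hp : 1 < p) : ∃ κ S, IsSigmoid p κ S := by
  set g : ℝ → ℝ := fun x => ‖(⟨x, 1⟩ : ℂ)‖ ^ (-p)
  have hpos : ∀ x, 0 < g x := fun x => Real.rpow_pos_of_pos (norm_mk_pos one_ne_zero x) _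
  have hint : Integrable g := integrable_norm_mk_one_rpow hp
  have hcont : Continuous g := continuous_norm_mk_rpow one_ne_zero _
  have hmass : 0 < ∫ x, g x := by
    rw [integral_pos_iff_support_of_nonneg (fun x => (hpos x).le) hint,
      Function.support_eq_univ fun x => (hpos x).ne']
    simp only [Real.volume_univ, ENNReal.zero_lt_top]
  set κ := (∫ x, g x)⁻¹ with hκ
  have hmem : ∀ x, κ * ∫ u in Iic x, g u ∈ Icc (0 : ℝ) 1 := fun x => by
    refine ⟨mul_nonneg (inv_pos.2 hmass).le (integral_nonneg fun u => (hpos u).le), ?_⟩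
    rw [hκ, inv_mul_le_one₀ hmass]
    exact setIntegral_le_integral hint (ae_of_all _ fun u => (hpos u).le)
  have hbot := (tendsto_integral_Iic_zero (f := g) (μ := volume) tendsto_id).const_mul κ
  have htop := ((aecover_Iic tendsto_id).integral_tendsto_of_countably_generated hint).const_mul κ
  rw [mul_zero] at hbot
  rw [hκ, inv_mul_cancel₀ hmass.ne'] at htop
  refine ⟨κ, fun x => ⟨_, hmem x⟩, inv_pos.2 hmass, fun x => ?_, hbot, htop⟩
  refine HasDerivAt.const_mul κ ?_
  have hsplit : ∀ y, ∫ u in Iic y, g u = (∫ u in Iic 0, g u) + ∫ u in 0..y, g u := fun y => by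
    rw [← intervalIntegral.integral_Iic_sub_Iic hint.integrableOn hint.integrableOn,
      add_sub_cancel]
  rw [funext hsplit]
  exact (hcont.integral_hasStrictDerivAt 0 x).hasDerivAt.const_add _

namespace IsSigmoid

variable {p κ : ℝ} {S : ℝ → unitInterval}

theorem strictMono (hS : IsSigmoid p κ S) : StrictMono S :=
  strictMono_of_hasDerivAt_pos hS.hasDerivAt
    fun x => mul_pos hS.pos (Real.rpow_pos_of_pos (norm_mk_pos one_ne_zero x) _)

theorem continuous (hS : IsSigmoid p κ S) : Continuous S :=
  continuous_induced_rng.2 (continuous_iff_continuousAt.2 fun x => (hS.hasDerivAt x).continuousAt)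

theorem hasDerivAt_comp_div (hS : IsSigmoid p κ S) (a t : ℝ) :
    HasDerivAt (fun t => (S (t / a) : ℝ)) (κ * ‖(⟨t / a, 1⟩ : ℂ)‖ ^ (-p) * a⁻¹) t := by
  rw [← one_div]
  exact (hS.hasDerivAt (t / a)).comp t ((hasDerivAt_id t).div_const a)

end IsSigmoid

variable {n : ℕ} {ℓ a : (Fin n → ℤ) → ℝ} {p κ : ℝ} {S : ℝ → unitInterval}

/-- The chart of `[0,1]` sending `{v} × ℝ` to the interior of `I_v` by the sigmoid `S`, spread out
over the scale `a v`. -/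
noncomputable def sigmoidChart (hℓ : IsLengthFunction ℓ) (a : (Fin n → ℤ) → ℝ)
    (S : ℝ → unitInterval) (x : (Fin n → ℤ) × ℝ) : unitInterval :=
  blockPoint hℓ x.1 (S (x.2 / a x.1))

theorem coe_sigmoidChart (hℓ : IsLengthFunction ℓ) (v : Fin n → ℤ) (t : ℝ) :
    (sigmoidChart hℓ a S (v, t) : ℝ) = leftEnd ℓ v + S (t / a v) * ℓ v := rfl

theorem fillsBlocks_sigmoidChart (hℓ : IsLengthFunction ℓ) (hS : IsSigmoid p κ S)
    (ha : ∀ v, 0 < a v) : FillsBlocks ℓ (sigmoidChart hℓ a S) where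
  strictMono v := (strictMono_blockPoint hℓ v).comp fun _ _ h =>
    hS.strictMono (div_lt_div_of_pos_right h (ha v))
  continuous v := by
    have hcont := hS.continuous.comp (continuous_id.div_const (a v))
    exact continuous_induced_rng.2
      (((continuous_subtype_val.comp hcont).mul_const (ℓ v)).const_add (leftEnd ℓ v))
  tendsto_atBot v := by
    have hlim := (hS.tendsto_atBot.comp (tendsto_id.atBot_div_const (ha v))).mul_const (ℓ v)
    simpa only [zero_mul, add_zero] using! hlim.const_add (leftEnd ℓ v)
  tendsto_atTop v := by
    have hlim := (hS.tendsto_atTop.comp (tendsto_id.atTop_div_const (ha v))).mul_const (ℓ v)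
    simpa only [one_mul] using! hlim.const_add (leftEnd ℓ v)

theorem abs_sigmoidChart_sub (hℓ : IsLengthFunction ℓ) (v : Fin n → ℤ) (s t : ℝ) :
    |(sigmoidChart hℓ a S (v, s) : ℝ) - sigmoidChart hℓ a S (v, t)| =
      ℓ v * |(S (s / a v) : ℝ) - S (t / a v)| := by
  rw [coe_sigmoidChart, coe_sigmoidChart, add_sub_add_left_eq_sub, ← sub_mul, abs_mul,
    abs_of_pos (hℓ.pos v), mul_comm]

theorem hasDerivAt_sigmoidChart (hℓ : IsLengthFunction ℓ) (hS : IsSigmoid p κ S) {ζ : ℝ}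
    {v : Fin n → ℤ} (ha : 0 < a v) (hv : ℓ v = ζ * a v ^ (1 - p)) (t : ℝ) :
    HasDerivAt (fun t => (sigmoidChart hℓ a S (v, t) : ℝ))
      (ζ * κ * ‖(⟨t, a v⟩ : ℂ)‖ ^ (-p)) t := by
  simp only [coe_sigmoidChart]
  refine (((hS.hasDerivAt_comp_div (a v) t).mul_const (ℓ v)).const_add _).congr_deriv ?_
  rw [norm_mk_div ha, Real.div_rpow (norm_nonneg _) ha.le, hv, Real.rpow_sub ha,
    Real.rpow_neg ha.le, Real.rpow_one]
  have := Real.rpow_pos_of_pos ha p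
  field_simp

end Sigmoid

section MeanValue

theorem norm_sub_le_of_norm_deriv_le_deriv {E : Type*} [NormedAddCommGroup E] [NormedSpace ℝ E]
    {F F' : ℝ → E} {g g' : ℝ → ℝ} (hF : ∀ x, HasDerivAt F (F' x) x)
    (hg : ∀ x, HasDerivAt g (g' x) x) (hle : ∀ x, ‖F' x‖ ≤ g' x) (s t : ℝ) :
    ‖F s - F t‖ ≤ |g s - g t| := by
  wlog hts : t ≤ s generalizing s t
  · rw [norm_sub_rev, abs_sub_comm]
    exact this t s (le_of_not_ge hts)
  refine le_trans ?_ (le_abs_self _)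
  exact image_norm_le_of_norm_deriv_right_le_deriv_boundary (f := fun x => F x - F t)
    (B := fun x => g x - g t) (fun x _ => ((hF x).sub_const _).continuousAt.continuousWithinAt)
    (fun x _ => ((hF x).sub_const _).hasDerivWithinAt) (by simp)
    (fun x => (hg x).sub_const _) (fun x _ => hle x) (right_mem_Icc.2 hts)

theorem abs_rpow_sub_rpow_le {p L x y : ℝ} (hp : 1 ≤ p) (hx : x ∈ Icc 0 L) (hy : y ∈ Icc 0 L) :
    |x ^ p - y ^ p| ≤ p * L ^ (p - 1) * |x - y| := by
  refine (convex_Icc 0 L).norm_image_sub_le_of_norm_hasDerivWithin_le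
    (fun z _ => (Real.hasDerivAt_rpow_const (Or.inr hp)).hasDerivWithinAt) (fun z hz => ?_) hy hx
  rw [Real.norm_of_nonneg (mul_nonneg (by linarith) (Real.rpow_nonneg hz.1 _))]
  gcongr
  exacts [hz.1, hz.2]

end MeanValue

section Mobius

/-- The Möbius map carrying `-ai` and `-c - bi` to `0` and `∞`; the power `p` of its absolute value
is, up to a constant, the ratio of the densities `‖t + c + bi‖ ^ (-p)` and `‖t + ai‖ ^ (-p)`. -/
noncomputable def mobius (a b c t : ℝ) : ℂ := ⟨t, a⟩ / ⟨t + c, b⟩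

variable {a b c K ε t : ℝ}

theorem norm_mobius (a b c t : ℝ) : ‖mobius a b c t‖ = ‖(⟨t, a⟩ : ℂ)‖ / ‖(⟨t + c, b⟩ : ℂ)‖ :=
  norm_div _ _

theorem mobius_eq_one_sub (hb : b ≠ 0) (a c t : ℝ) :
    mobius a b c t = 1 - ⟨c, b - a⟩ / ⟨t + c, b⟩ := by
  have hw : (⟨t + c, b⟩ : ℂ) ≠ 0 := norm_pos_iff.1 (norm_mk_pos hb _)
  rw [mobius, eq_sub_iff_add_eq, ← add_div, div_eq_one_iff_eq hw]
  apply Complex.ext <;> simp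

theorem hasDerivAt_mobius (hb : b ≠ 0) (a c t : ℝ) :
    HasDerivAt (mobius a b c) (⟨c, b - a⟩ / ⟨t + c, b⟩ ^ 2) t := by
  have hw : (⟨t + c, b⟩ : ℂ) ≠ 0 := norm_pos_iff.1 (norm_mk_pos hb _)
  refine ((hasDerivAt_mk t a).div ((hasDerivAt_mk (t + c) b).comp_add_const t c) hw).congr_deriv ?_
  congr 1
  apply Complex.ext <;> simp

theorem tendsto_mobius (hb : b ≠ 0) (a c : ℝ) : Tendsto (mobius a b c) (cocompact ℝ) (𝓝 1) := by
  have hw : Tendsto (fun t : ℝ => ‖(⟨t + c, b⟩ : ℂ)‖) (cocompact ℝ) atTop :=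
    tendsto_atTop_mono (fun t => Complex.abs_re_le_norm ⟨t + c, b⟩)
      ((tendsto_norm_cocompact_atTop (E := ℝ)).comp
        (Homeomorph.addRight c).isClosedEmbedding.tendsto_cocompact)
  have hinv := tendsto_inv₀_cobounded.comp (tendsto_norm_atTop_iff_cobounded.1 hw)
  have hlim := (hinv.const_mul (⟨c, b - a⟩ : ℂ)).const_sub 1
  rw [mul_zero, sub_zero] at hlim
  exact hlim.congr fun t => (mobius_eq_one_sub hb a c t).symm

theorem norm_le_mul_norm_add (hK : 0 ≤ K) (hc : |c| ≤ K * a) (hba : |b - a| ≤ K * a)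
    (hab : a ≤ K * b) (t : ℝ) : ‖(⟨t, a⟩ : ℂ)‖ ≤ (1 + 2 * K ^ 2) * ‖(⟨t + c, b⟩ : ℂ)‖ := by
  have hz : (⟨t, a⟩ : ℂ) = ⟨t + c, b⟩ - ⟨c, b - a⟩ := by apply Complex.ext <;> simp
  have hδ : ‖(⟨c, b - a⟩ : ℂ)‖ ≤ |c| + |b - a| := Complex.norm_le_abs_re_add_abs_im _
  calc ‖(⟨t, a⟩ : ℂ)‖ ≤ ‖(⟨t + c, b⟩ : ℂ)‖ + ‖(⟨c, b - a⟩ : ℂ)‖ := hz ▸ norm_sub_le _ _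
    _ ≤ ‖(⟨t + c, b⟩ : ℂ)‖ + 2 * K * (K * b) := by nlinarith
    _ ≤ ‖(⟨t + c, b⟩ : ℂ)‖ + 2 * K * (K * ‖(⟨t + c, b⟩ : ℂ)‖) := by
      gcongr
      exact (le_abs_self b).trans (abs_le_norm_mk_right _ b)
    _ = _ := by ring

theorem norm_deriv_mobius_le {p : ℝ} (hp : p ≤ 2) (ha : 0 < a) (hK : 0 ≤ K) (hε : ε ∈ Icc 0 1)
    (hc : |c| ≤ K * ε * a) (hba : |b - a| ≤ K * ε * a) (hab : a ≤ K * b) :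
    ‖(⟨c, b - a⟩ / ⟨t + c, b⟩ ^ 2 : ℂ)‖ ≤
      2 * K * (1 + 2 * K ^ 2) ^ 2 * ε * (‖(⟨t / a, 1⟩ : ℂ)‖ ^ (-p) * a⁻¹) := by
  have hδ : ‖(⟨c, b - a⟩ : ℂ)‖ ≤ 2 * K * ε * a :=
    (Complex.norm_le_abs_re_add_abs_im _).trans (by linarith)
  have hz := norm_mk_pos ha.ne' t
  have hεa : K * ε * a ≤ K * a := by
    gcongr
    exact mul_le_of_le_one_right hK hε.2
  have hzw : ‖(⟨t, a⟩ : ℂ)‖ ≤ (1 + 2 * K ^ 2) * ‖(⟨t + c, b⟩ : ℂ)‖ :=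
    norm_le_mul_norm_add hK (hc.trans hεa) (hba.trans hεa) hab t
  have hone : 1 ≤ ‖(⟨t / a, 1⟩ : ℂ)‖ := abs_one.symm.trans_le (abs_le_norm_mk_right _ 1)
  rw [norm_div, norm_pow]
  calc ‖(⟨c, b - a⟩ : ℂ)‖ / ‖(⟨t + c, b⟩ : ℂ)‖ ^ 2
      ≤ 2 * K * ε * a / (‖(⟨t, a⟩ : ℂ)‖ / (1 + 2 * K ^ 2)) ^ 2 := by
        have hnonneg := (norm_nonneg _).trans hδ
        gcongr
        · exact (div_le_iff₀' (by positivity)).2 hzw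
    _ = 2 * K * (1 + 2 * K ^ 2) ^ 2 * ε * (‖(⟨t / a, 1⟩ : ℂ)‖ ^ (-2 : ℝ) * a⁻¹) := by
        rw [norm_mk_div ha, Real.rpow_neg (by positivity), Real.rpow_two]
        field_simp
    _ ≤ _ := by
        have := hε.1
        gcongr

theorem abs_norm_mobius_rpow_sub_le {p κ : ℝ} {S : ℝ → unitInterval} (hS : IsSigmoid p κ S)
    (hp : p ∈ Icc 1 2) (ha : 0 < a) (hb : 0 < b) (hK : 0 ≤ K) (hε : ε ∈ Icc 0 1)
    (hc : |c| ≤ K * ε * a) (hba : |b - a| ≤ K * ε * a) (hab : a ≤ K * b) (s t : ℝ) :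
    |‖mobius a b c s‖ ^ p - ‖mobius a b c t‖ ^ p| ≤
      p * (1 + 2 * K ^ 2) ^ (p - 1) * (2 * K * (1 + 2 * K ^ 2) ^ 2 * κ⁻¹) *
        (ε * |(S (s / a) : ℝ) - S (t / a)|) := by
  have hεa : K * ε * a ≤ K * a := by
    gcongr
    exact mul_le_of_le_one_right hK hε.2
  have hmem : ∀ t, ‖mobius a b c t‖ ∈ Icc 0 (1 + 2 * K ^ 2) := fun t => by
    refine ⟨norm_nonneg _, ?_⟩
    rw [norm_mobius, div_le_iff₀ (norm_mk_pos hb.ne' _)]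
    exact norm_le_mul_norm_add hK (hc.trans hεa) (hba.trans hεa) hab t
  have hsub := norm_sub_le_of_norm_deriv_le_deriv (hasDerivAt_mobius hb.ne' a c)
    (fun x => (hS.hasDerivAt_comp_div a x).const_mul (2 * K * (1 + 2 * K ^ 2) ^ 2 * κ⁻¹ * ε))
    (fun x => (norm_deriv_mobius_le hp.2 ha hK hε hc hba hab).trans_eq ?_) s t
  · refine (abs_rpow_sub_rpow_le hp.1 (hmem s) (hmem t)).trans ?_
    rw [mul_assoc _ _ (ε * _)]
    have := hp.1
    gcongr
    refine (abs_norm_sub_norm_le _ _).trans (hsub.trans_eq ?_)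
    have := hε.1
    have := hS.pos
    rw [← mul_sub, abs_mul, abs_of_nonneg (by positivity), mul_assoc _ ε]
  · have := hS.pos.ne'
    field_simp

theorem norm_mobius_rpow_mul (ha : a ≠ 0) (c t p q : ℝ) :
    ‖mobius a b c t‖ ^ p * (q * ‖(⟨t, a⟩ : ℂ)‖ ^ (-p)) = q * ‖(⟨t + c, b⟩ : ℂ)‖ ^ (-p) := by
  have hz := Real.rpow_pos_of_pos (norm_mk_pos ha t) p
  rw [norm_mobius, Real.div_rpow (norm_nonneg _) (norm_nonneg _), Real.rpow_neg (norm_nonneg _),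
    Real.rpow_neg (norm_nonneg _)]
  field_simp

theorem isC1HolderDiffeo_of_sigmoidChart {n : ℕ} {ℓ a c : (Fin n → ℤ) → ℝ}
    {σ : Equiv.Perm (Fin n → ℤ)} {p κ ζ α K : ℝ} {S : ℝ → unitInterval}
    {h : unitInterval ≃ₜ unitInterval} (hS : IsSigmoid p κ S) (hp : p ∈ Icc 1 2)
    (hℓ : IsLengthFunction ℓ) (ha : ∀ v, 0 < a v) (hℓa : ∀ v, ℓ v = ζ * a v ^ (1 - p))
    (hσ : ∀ v w, toLex (σ v) < toLex (σ w) ↔ toLex v < toLex w)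
    (hh : ∀ v t, h (sigmoidChart hℓ a S (v, t)) = sigmoidChart hℓ a S (σ v, t + c v))
    (hα : α ∈ Ioc 0 1) (hK : 0 ≤ K) (hc : ∀ v, |c v| ≤ K * ℓ v ^ α * a v)
    (haσ : ∀ v, |a (σ v) - a v| ≤ K * ℓ v ^ α * a v) (hσa : ∀ v, a v ≤ K * a (σ v)) :
    IsC1HolderDiffeo α h := by
  have hℓ0 : ∀ v, 0 ≤ ℓ v := fun v => (hℓ.pos v).le
  have hℓ1 : ∀ v, ℓ v ≤ 1 := fun v =>
    (le_add_of_nonneg_left (hℓ.leftEnd_nonneg v)).trans (hℓ.leftEnd_add_le_one v)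
  have hM : 0 ≤ p * (1 + 2 * K ^ 2) ^ (p - 1) * (2 * K * (1 + 2 * K ^ 2) ^ 2 * κ⁻¹) := by
    have := hS.pos
    have := hp.1
    positivity
  refine (fillsBlocks_sigmoidChart hℓ hS ha).isC1HolderDiffeo hℓ
    (q := fun x => ζ * κ * ‖(⟨x.2, a x.1⟩ : ℂ)‖ ^ (-p))
    (D := fun x => ‖mobius (a x.1) (a (σ x.1)) (c x.1) x.2‖ ^ p)
    (fun v => hasDerivAt_sigmoidChart hℓ hS (ha v) (hℓa v)) hσ hh hα.1 hM
    (fun x => Real.rpow_pos_of_pos ?_ p)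
    (fun v t => norm_mobius_rpow_mul (ha v).ne' (c v) t p (ζ * κ)) (fun v s t => ?_) fun v => ?_
  · rw [norm_mobius]
    exact div_pos (norm_mk_pos (ha _).ne' _) (norm_mk_pos (ha _).ne' _)
  · refine (abs_norm_mobius_rpow_sub_le hS hp (ha v) (ha (σ v)) hK
      ⟨Real.rpow_nonneg (hℓ0 v) α, Real.rpow_le_one (hℓ0 v) (hℓ1 v) hα.1.le⟩
      (hc v) (haσ v) (hσa v) s t).trans ?_
    rw [abs_sigmoidChart_sub, Real.mul_rpow (hℓ0 v) (abs_nonneg _)]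
    have hS1 : |(S (s / a v) : ℝ) - S (t / a v)| ≤ 1 :=
      (abs_sub_le_of_le_of_le (S _).2.1 (S _).2.2 (S _).2.1 (S _).2.2).trans_eq (sub_zero 1)
    gcongr
    · exact Real.rpow_nonneg (hℓ0 v) α
    · exact Real.self_le_rpow_of_le_one (abs_nonneg _) hS1 hα.2
  · have hlim := (tendsto_mobius (ha (σ v)).ne' (a v) (c v)).norm.rpow_const
      (p := p) (Or.inl (norm_ne_zero_iff.2 one_ne_zero))
    rwa [norm_one, Real.one_rpow] at hlim

end Mobius

section Level

variable {n : ℕ}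

/-- The homogeneous size of `v`: the least `r ≥ 1` such that the `k`-th coordinate, counted from
`1`, is at most `r ^ k` in absolute value, for every `k`. -/
noncomputable def level (v : Fin n → ℤ) : ℕ :=
  sInf {r : ℕ | 1 ≤ r ∧ ∀ k : Fin n, |v k| ≤ (r : ℤ) ^ ((k : ℕ) + 1)}

theorem level_mem (v : Fin n → ℤ) :
    1 ≤ level v ∧ ∀ k : Fin n, |v k| ≤ (level v : ℤ) ^ ((k : ℕ) + 1) := by
  refine Nat.sInf_mem (s := {r : ℕ | 1 ≤ r ∧ ∀ k : Fin n, |v k| ≤ (r : ℤ) ^ ((k : ℕ) + 1)})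
    ⟨1 + ∑ k, (v k).natAbs, le_self_add, fun k => ?_⟩
  have hsum : (v k).natAbs ≤ ∑ k, (v k).natAbs :=
    Finset.single_le_sum (f := fun k => (v k).natAbs) (fun _ _ => Nat.zero_le _) (Finset.mem_univ k)
  have hle : |v k| ≤ ((1 + ∑ k, (v k).natAbs : ℕ) : ℤ) := by
    rw [Int.abs_eq_natAbs]
    exact_mod_cast hsum.trans le_add_self
  exact hle.trans (le_self_pow₀ (by exact_mod_cast le_self_add) (Nat.succ_ne_zero _))

theorem one_le_level (v : Fin n → ℤ) : 1 ≤ level v := (level_mem v).1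

theorem abs_le_level_pow (v : Fin n → ℤ) (k : Fin n) : |v k| ≤ (level v : ℤ) ^ ((k : ℕ) + 1) :=
  (level_mem v).2 k

theorem exists_level_baseAct_le_add (f : lowerUnitriangular (n + 1)) :
    ∃ C : ℕ, ∀ v : Fin n → ℤ, level (baseAct f v) ≤ level v + C ∧
      |shift f v| ≤ (C : ℤ) * (level v : ℤ) ^ n := by
  obtain ⟨C, hC⟩ := exists_abs_act_sub_le f
  refine ⟨C, fun v => ?_⟩
  have hbound : ∀ k : Fin (n + 1), |act f (Fin.snoc v 0) k - (Fin.snoc v 0 : Fin (n + 1) → ℤ) k| ≤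
      C * (level v : ℤ) ^ (k : ℕ) := fun k =>
    hC (Fin.snoc v 0) k (level v) (one_le_level v) fun l hl => by
      induction l using Fin.lastCases with
      | last => exact absurd hl (not_lt.2 (Fin.le_last _))
      | cast l => simpa only [Fin.snoc_castSucc, Fin.val_castSucc] using abs_le_level_pow v l
  simp only [act_snoc] at hbound
  refine ⟨Nat.sInf_le ⟨(one_le_level v).trans le_self_add, fun k => ?_⟩, ?_⟩
  · have hk := hbound k.castSucc
    rw [Fin.snoc_castSucc, Fin.snoc_castSucc, Fin.val_castSucc] at hk
    push_cast
    calc |baseAct f v k| ≤ |baseAct f v k - v k| + |v k| := by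
          simpa only [sub_add_cancel] using abs_add_le (baseAct f v k - v k) (v k)
      _ ≤ C * (level v : ℤ) ^ (k : ℕ) + (level v : ℤ) ^ ((k : ℕ) + 1) :=
          add_le_add hk (abs_le_level_pow v k)
      _ = (level v : ℤ) ^ (k : ℕ) * (level v + C) := by ring
      _ ≤ (level v + C : ℤ) ^ (k : ℕ) * (level v + C) := by
          gcongr
          exact le_add_of_nonneg_right C.cast_nonneg
      _ = _ := (pow_succ _ _).symm
  · simpa only [Fin.snoc_last, zero_add, sub_zero, Fin.val_last] using hbound (Fin.last n)

theorem exists_abs_level_baseAct_sub_le (f : lowerUnitriangular (n + 1)) :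
    ∃ C : ℕ, ∀ v : Fin n → ℤ, |(level (baseAct f v) : ℝ) - level v| ≤ C ∧
      |(shift f v : ℝ)| ≤ C * (level v : ℝ) ^ n := by
  obtain ⟨C, hC⟩ := exists_level_baseAct_le_add f
  obtain ⟨C', hC'⟩ := exists_level_baseAct_le_add f⁻¹
  refine ⟨C + C', fun v => ⟨?_, ?_⟩⟩
  · have hinv : level v ≤ level (baseAct f v) + C' := by
      simpa only [map_inv, Equiv.Perm.inv_def, Equiv.symm_apply_apply] using (hC' (baseAct f v)).1
    have hup : (level (baseAct f v) : ℝ) ≤ level v + C := by exact_mod_cast (hC v).1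
    have hdown : (level v : ℝ) ≤ level (baseAct f v) + C' := by exact_mod_cast hinv
    push_cast
    rw [abs_le]
    constructor <;> linarith [C.cast_nonneg (α := ℝ), C'.cast_nonneg (α := ℝ)]
  · have hshift : |(shift f v : ℝ)| ≤ C * (level v : ℝ) ^ n := by exact_mod_cast (hC v).2
    refine hshift.trans ?_
    gcongr
    exact le_self_add

theorem exists_level_pow_bounds {s : ℕ} (hs : n ≤ s) (f : lowerUnitriangular (n + 1)) :
    ∃ K : ℝ, 0 ≤ K ∧ ∀ v : Fin n → ℤ, |(shift f v : ℝ)| ≤ K * (level v : ℝ) ^ s ∧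
      |(level (baseAct f v) : ℝ) ^ (s + 1) - (level v : ℝ) ^ (s + 1)| ≤ K * (level v : ℝ) ^ s ∧
      (level v : ℝ) ^ (s + 1) ≤ K * (level (baseAct f v) : ℝ) ^ (s + 1) := by
  obtain ⟨C, hC⟩ := exists_abs_level_baseAct_sub_le f
  have hC0 : (0 : ℝ) ≤ C := C.cast_nonneg
  refine ⟨(s + 1) * (1 + C) ^ (s + 1), by positivity, fun v => ?_⟩
  obtain ⟨hlevel, hshift⟩ := hC v
  have hx : (1 : ℝ) ≤ level v := by exact_mod_cast one_le_level v
  have hy : (1 : ℝ) ≤ level (baseAct f v) := by exact_mod_cast one_le_level _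
  generalize (level v : ℝ) = x at *
  generalize (level (baseAct f v) : ℝ) = y at *
  have hyx : y ≤ (1 + C) * x := by nlinarith [abs_le.1 hlevel]
  have hxy : x ≤ (1 + C) * y := by nlinarith [abs_le.1 hlevel]
  have hs1 : (1 : ℝ) ≤ s + 1 := le_add_of_nonneg_left s.cast_nonneg
  refine ⟨?_, ?_, ?_⟩
  · calc |(shift f v : ℝ)| ≤ C * x ^ n := hshift
      _ ≤ (1 + C) ^ (s + 1) * x ^ s := by
        gcongr
        exact (le_add_of_nonneg_left zero_le_one).trans
          (le_self_pow₀ (le_add_of_nonneg_right hC0) s.succ_ne_zero)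
      _ ≤ (s + 1) * (1 + C) ^ (s + 1) * x ^ s := by
        gcongr
        exact le_mul_of_one_le_left (by positivity) hs1
  · have hmax : max |y| |x| ≤ (1 + C) * x := by
      rw [abs_of_nonneg (by linarith), abs_of_nonneg (by linarith)]
      exact max_le hyx (le_mul_of_one_le_left (by linarith) (le_add_of_nonneg_right hC0))
    calc |y ^ (s + 1) - x ^ (s + 1)| ≤ |y - x| * ↑(s + 1) * max |y| |x| ^ s :=
          abs_pow_sub_pow_le ..
      _ ≤ (1 + C) * ↑(s + 1) * ((1 + C) * x) ^ s := by
        gcongr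
        linarith
      _ = _ := by
        rw [mul_pow]
        push_cast
        ring
  · calc x ^ (s + 1) ≤ ((1 + C) * y) ^ (s + 1) := by gcongr
      _ = (1 + C) ^ (s + 1) * y ^ (s + 1) := mul_pow ..
      _ ≤ _ := by
        gcongr
        exact le_mul_of_one_le_left (by positivity) hs1

theorem summable_prod_pi {g : ℤ → ℝ} (hg : Summable g) (hg0 : ∀ x, 0 ≤ g x) (n : ℕ) :
    Summable fun v : Fin n → ℤ => ∏ k, g (v k) := by
  induction n with
  | zero => exact Summable.of_finite
  | succ n ih =>
    rw [← (Fin.consEquiv fun _ : Fin (n + 1) => ℤ).summable_iff]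
    refine (hg.mul_of_nonneg ih hg0 fun v => Finset.prod_nonneg fun k _ => hg0 (v k)).congr
      fun p => ?_
    simp only [Function.comp_apply, Fin.consEquiv_apply, Fin.prod_univ_succ, Fin.cons_zero,
      Fin.cons_succ]

theorem summable_max_one_abs_rpow {e : ℝ} (he : 1 < e) :
    Summable fun x : ℤ => (max 1 |(x : ℝ)|) ^ (-e) := by
  refine Summable.of_nonneg_of_le (fun x => by positivity) (fun x => ?_)
    ((Real.summable_abs_int_rpow he).add (hasSum_ite_eq (0 : ℤ) (1 : ℝ)).summable)
  by_cases hx : x = 0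
  · subst hx
    simp [Real.zero_rpow (by linarith : -e ≠ 0)]
  · have hx1 : (1 : ℝ) ≤ |(x : ℝ)| := by exact_mod_cast Int.one_le_abs hx
    simp only [max_eq_right hx1, if_neg hx, add_zero, le_refl]

theorem sum_fin_add_one (n : ℕ) : ∑ k : Fin n, ((k : ℝ) + 1) = n * (n + 1) / 2 := by
  induction n with
  | zero => simp
  | succ n ih =>
    rw [Fin.sum_univ_castSucc]
    simp only [Fin.val_castSucc, Fin.val_last, ih]
    push_cast
    ring

theorem level_rpow_le_prod {e : ℝ} (he : 0 ≤ e) (v : Fin n → ℤ) :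
    (level v : ℝ) ^ (-(n * (n + 1) / 2 * e)) ≤ ∏ k, (max 1 |(v k : ℝ)|) ^ (-e) := by
  have hr : (1 : ℝ) ≤ level v := by exact_mod_cast one_le_level v
  rw [← mul_neg, ← sum_fin_add_one, Finset.sum_mul, Real.rpow_sum_of_pos (by linarith)]
  refine Finset.prod_le_prod (fun k _ => by positivity) fun k _ => ?_
  rw [Real.rpow_mul (by linarith)]
  refine Real.rpow_le_rpow_of_nonpos (by positivity) ?_ (by linarith)
  rw [← Nat.cast_succ, Real.rpow_natCast]
  refine max_le (one_le_pow₀ hr) ?_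
  exact_mod_cast abs_le_level_pow v k

theorem summable_level_rpow {β : ℝ} (hβ : (n : ℝ) * (n + 1) / 2 < β) :
    Summable fun v : Fin n → ℤ => (level v : ℝ) ^ (-β) := by
  rcases n.eq_zero_or_pos with rfl | hn
  · exact Summable.of_finite
  have hD : (0 : ℝ) < (n : ℝ) * (n + 1) / 2 := by positivity
  have he : 1 < β / (n * (n + 1) / 2) := (one_lt_div hD).2 hβ
  refine Summable.of_nonneg_of_le (fun v => by positivity) (fun v => ?_)
    (summable_prod_pi (summable_max_one_abs_rpow he) (fun x => by positivity) n)
  simpa only [mul_div_cancel₀ β hD.ne'] using level_rpow_le_prod (zero_le_one.trans he.le) v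

end Level

section SmoothModel

variable {n : ℕ} {x ζ α : ℝ} {s : ℕ}

theorem rpow_neg_one_div_eq (hx : 0 ≤ x) (s : ℕ) (α : ℝ) :
    x ^ (-(1 / α)) = (x ^ (s + 1)) ^ (1 - (1 + 1 / (α * (s + 1)))) := by
  have hs : (s : ℝ) + 1 ≠ 0 := by positivity
  rw [← Real.rpow_natCast, ← Real.rpow_mul hx, Nat.cast_succ]
  congr 1
  field_simp
  ring

theorem mul_rpow_neg_one_div_rpow_mul_pow (hx : 0 < x) (hζ : 0 ≤ ζ) (hα : α ≠ 0) (s : ℕ) :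
    (ζ * x ^ (-(1 / α))) ^ α * x ^ (s + 1) = ζ ^ α * x ^ s := by
  rw [Real.mul_rpow hζ (by positivity), ← Real.rpow_mul hx.le, neg_mul, one_div_mul_cancel hα,
    Real.rpow_neg_one, mul_assoc, pow_succ', inv_mul_cancel_left₀ hx.ne']

/-- Any `s ≥ n` makes the shifts, which are `O(level v ^ n)`, small against the scale
`level v ^ (s + 1)`; the bound `1 / α ≤ s + 1` keeps the exponent of the sigmoid at most `2`. -/
theorem isC1HolderDiffeo_of_level_sigmoidChart {S : ℝ → unitInterval} {κ : ℝ}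
    {h : unitInterval ≃ₜ unitInterval} (hα : α ∈ Ioc 0 1) (hζ : 0 < ζ) (hns : n ≤ s)
    (hαs : 1 / α ≤ s + 1) (hS : IsSigmoid (1 + 1 / (α * (s + 1))) κ S)
    (hℓ : IsLengthFunction fun v : Fin n → ℤ => ζ * (level v : ℝ) ^ (-(1 / α)))
    (f : lowerUnitriangular (n + 1))
    (hh : ∀ p, h (sigmoidChart hℓ (fun v => (level v : ℝ) ^ (s + 1)) S p) =
      sigmoidChart hℓ (fun v => (level v : ℝ) ^ (s + 1)) S (skew f p)) :
    IsC1HolderDiffeo α h := by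
  have hα0 : 0 < α := hα.1
  have hlevel : ∀ v : Fin n → ℤ, 0 < (level v : ℝ) := fun v => by exact_mod_cast one_le_level v
  obtain ⟨K, hK, hbound⟩ := exists_level_pow_bounds hns f
  have hp : 1 + 1 / (α * (s + 1)) ∈ Icc (1 : ℝ) 2 := by
    have hle : 1 / (α * (s + 1)) ≤ 1 := by
      rw [← div_div]
      exact div_le_one_of_le₀ hαs (by positivity)
    exact ⟨le_add_of_nonneg_right (by positivity), by linarith⟩
  have hscale : ∀ v : Fin n → ℤ, K * (level v : ℝ) ^ s ≤
      K * (1 + (ζ ^ α)⁻¹) * (ζ * (level v : ℝ) ^ (-(1 / α))) ^ α * (level v : ℝ) ^ (s + 1) :=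
    fun v => by
      rw [mul_assoc _ (_ ^ α), mul_rpow_neg_one_div_rpow_mul_pow (hlevel v) hζ.le hα0.ne']
      calc K * (level v : ℝ) ^ s = K * (ζ ^ α)⁻¹ * (ζ ^ α * (level v : ℝ) ^ s) := by
            rw [mul_assoc, inv_mul_cancel_left₀ (by positivity)]
        _ ≤ K * (1 + (ζ ^ α)⁻¹) * (ζ ^ α * (level v : ℝ) ^ s) := by
            gcongr
            exact le_add_of_nonneg_left zero_le_one
  refine isC1HolderDiffeo_of_sigmoidChart (σ := baseAct f) (c := fun v => shift f v)
    (K := K * (1 + (ζ ^ α)⁻¹)) hS hp hℓ (fun v => pow_pos (hlevel v) _)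
    (fun v => by rw [← rpow_neg_one_div_eq (hlevel v).le]) (fun v w => baseAct_lt_baseAct_iff f)
    (fun v t => hh (v, t)) hα (by positivity) (fun v => (hbound v).1.trans (hscale v))
    (fun v => (hbound v).2.1.trans (hscale v)) fun v => (hbound v).2.2.trans ?_
  gcongr
  exact le_mul_of_one_le_right hK (le_add_of_nonneg_right (by positivity))

theorem IsFarbFranksAction.exists_conj_isC1HolderDiffeo
    {φ : lowerUnitriangular (n + 1) →* (unitInterval ≃ₜ unitInterval)}
    (hφ : IsFarbFranksAction (n + 1) φ) (hα : α ∈ Ioc 0 1)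
    (hαn : (n : ℝ) * (n + 1) / 2 < 1 / α) :
    ∃ ψ : lowerUnitriangular (n + 1) →* (unitInterval ≃ₜ unitInterval),
      (∀ f, IsC1HolderDiffeo α (ψ f)) ∧ TopConj φ ψ := by
  have hα0 : 0 < α := hα.1
  have hlevel : ∀ v : Fin n → ℤ, 0 < (level v : ℝ) := fun v => by exact_mod_cast one_le_level v
  obtain ⟨s, hns, hαs⟩ : ∃ s : ℕ, n ≤ s ∧ 1 / α ≤ s + 1 := by
    obtain ⟨s, hs⟩ := exists_nat_ge (1 / α)
    refine ⟨max n s, le_max_left n s, hs.trans ?_⟩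
    exact_mod_cast (le_max_right n s).trans (Nat.le_succ _)
  obtain ⟨ζ, hζ, hℓ⟩ := exists_isLengthFunction_mul
    (fun v => Real.rpow_pos_of_pos (hlevel v) (-(1 / α))) (summable_level_rpow hαn)
  obtain ⟨κ, S, hS⟩ := exists_isSigmoid (p := 1 + 1 / (α * (s + 1)))
    (lt_add_of_pos_right 1 (by positivity))
  have hQ := (fillsBlocks_sigmoidChart hℓ hS fun v => pow_pos (hlevel v) (s + 1)).isLexEmbedding hℓ
  obtain ⟨ψ, hψ, hconj⟩ := hφ.exists_conjugate hQ
  exact ⟨ψ, fun f => isC1HolderDiffeo_of_level_sigmoidChart hα hζ hns hαs hS hℓ f (hψ f), hconj⟩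

end SmoothModel

end FarbFranks

theorem theoremB_general (d : ℕ) (hd : 1 ≤ d) (α : ℝ) (hα : 0 < α) (hα1 : α ≤ 1)
    (hαd : α * ((d : ℝ) * ((d : ℝ) - 1)) < 2) :
    (∃ φ : lowerUnitriangular d →* (unitInterval ≃ₜ unitInterval),
      FarbFranks.IsFarbFranksAction d φ) ∧
    ∀ φ : lowerUnitriangular d →* (unitInterval ≃ₜ unitInterval),
      FarbFranks.IsFarbFranksAction d φ →
      ∃ ψ : lowerUnitriangular d →* (unitInterval ≃ₜ unitInterval),
        (∀ f, FarbFranks.IsC1HolderDiffeo α (ψ f)) ∧ FarbFranks.TopConj φ ψ := by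
  obtain ⟨n, rfl⟩ := Nat.exists_eq_add_of_le' hd
  have hαn : (n : ℝ) * (n + 1) / 2 < 1 / α := by
    rw [lt_div_iff₀ hα]
    push_cast at hαd
    linarith
  exact ⟨FarbFranks.exists_isFarbFranksAction n,
    fun φ hφ => hφ.exists_conj_isC1HolderDiffeo ⟨hα, hα1⟩ hαn⟩

theorem theoremB (d : ℕ) (hd : 2 ≤ d) (α : ℝ) (hα : 0 < α)
    (hαd : α < 2 / ((d : ℝ) * ((d : ℝ) - 1))) :
    (∃ φ : lowerUnitriangular d →* (unitInterval ≃ₜ unitInterval),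
      FarbFranks.IsFarbFranksAction d φ) ∧
    ∀ φ : lowerUnitriangular d →* (unitInterval ≃ₜ unitInterval),
      FarbFranks.IsFarbFranksAction d φ →
      ∃ ψ : lowerUnitriangular d →* (unitInterval ≃ₜ unitInterval),
        (∀ f, FarbFranks.IsC1HolderDiffeo α (ψ f)) ∧ FarbFranks.TopConj φ ψ := by
  have hd2 : (2 : ℝ) ≤ d := by exact_mod_cast hd
  have hprod : 2 ≤ (d : ℝ) * (d - 1) := by nlinarith
  have hαd' : α * ((d : ℝ) * (d - 1)) < 2 := (lt_div_iff₀ (by linarith)).1 hαd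
  exact theoremB_general d (one_le_two.trans hd) α hα (by nlinarith) hαd'
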